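/- Let $K$ be a field. A curve over $K$ is a nonsingular, projective, geometrically irreducible one-dimensional variety over $K$, and a cover of curves over $K$ is a nonconstant separable $K$-morphism between curves over $K$. The degree of a cover $\phi\colon C\to D$ is $\deg\phi=[K(C):K(D)]$. A cover is indecomposable if its degree is at least $2$ and it cannot be written as the composition of two covers (of curves over $K$) which both have degree at least $2$. Let $\mathrm{Aut}(\phi)$ denote the group of automorphisms $\sigma$ of $C$ defined over $K$ with $\phi\circ\sigma=\phi$. Let $\mathrm{Mon}(\phi)$ denote the Galois group of the Galois closure of $K(C)/K(D)$, viewed as a group of permutations of the set of embeddings of $K(C)$ into a fixed algebraic closure of $K(D)$ which restrict to the identity on $K(D)$. If $\phi\colon C\to D$ is an indecomposable cover of curves over $K$, then the following are equivalent: (1) $\deg\phi$ is prime, and both $\mathrm{Aut}(\phi)$ and $\mathrm{Mon}(\phi)$ are cyclic of order $\deg\phi$; (2) $\mathrm{Mon}(\phi)$ is abelian; (3) $\mathrm{Mon}(\phi)$ is regular, that is, transitive with trivial point stabilizers; (4) $|\mathrm{Aut}(\phi)|>1$. -/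

import Mathlib

universe u

open CategoryTheory AlgebraicGeometry

noncomputable section

namespace CurveCover

/-! ### Projective space and curves over a field -/

section Curves

variable (K : Type u) [Field K]

attribute [local instance] MvPolynomial.gradedAlgebra

/-- Projective `n`-space over `K`, as a scheme over `Spec K`: the scheme `Proj K[x₀, …, xₙ]` for the
usual grading, with the structure morphism coming from `K → K[x₀, …, xₙ]₀`. -/
def projectiveSpace (n : ℕ) : Over (Spec (.of K)) :=
  Over.mk (Proj.toSpecZero (MvPolynomial.homogeneousSubmodule (Fin (n + 1)) K) ≫
    Spec.map (CommRingCat.ofHom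
      (algebraMap K (MvPolynomial.homogeneousSubmodule (Fin (n + 1)) K 0))))

variable {K}

/-- A curve over `K`: a nonsingular, projective, geometrically irreducible one-dimensional variety
over `K`. Nonsingular means that all local rings are regular; projective means that there is a
closed immersion over `K` into some projective space over `K`. -/
class IsCurve (C : Over (Spec (.of K))) : Prop where
  isIntegral : IsIntegral C.left
  nonsingular : ∀ x : C.left, IsRegularLocalRing (C.left.presheaf.stalk x)
  projective : ∃ (n : ℕ) (i : C ⟶ projectiveSpace K n), IsClosedImmersion i.left
  geometricallyIrreducible : GeometricallyIrreducible C.hom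
  dim_eq_one : topologicalKrullDim C.left = 1

instance (C : Over (Spec (.of K))) [IsCurve C] : IsIntegral C.left := IsCurve.isIntegral

end Curves

/-! ### Nonconstant morphisms and function field extensions -/

section Covers

variable {K : Type u} [Field K] {C D : Over (Spec (.of K))}

/-- The morphism does not send all points to one point. -/
class Nonconstant (φ : C ⟶ D) : Prop where
  not_constant : ¬ ∃ y : D.left, ∀ x : C.left, φ.left x = y

/-- In an irreducible one-dimensional scheme, a non-generic point has no proper specialization. -/
theorem eq_of_specializes {X : Scheme.{u}} [IrreducibleSpace X] (hX : topologicalKrullDim X = 1)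
    {y y' : X} (hy : y ≠ genericPoint X) (h : y ⤳ y') : y' = y := by
  by_contra hne
  let a : TopologicalSpace.IrreducibleCloseds X :=
    ⟨closure {y'}, isIrreducible_singleton.closure, isClosed_closure⟩
  let b : TopologicalSpace.IrreducibleCloseds X :=
    ⟨closure {y}, isIrreducible_singleton.closure, isClosed_closure⟩
  let c : TopologicalSpace.IrreducibleCloseds X :=
    ⟨Set.univ, IrreducibleSpace.isIrreducible_univ X, isClosed_univ⟩
  have hab : a < b := by
    refine lt_of_le_of_ne (show closure {y'} ⊆ closure {y} from h.closure_subset) fun e => hne ?_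
    have e' : closure {y'} = closure {y} := congrArg TopologicalSpace.IrreducibleCloseds.carrier e
    exact (inseparable_iff_closure_eq.2 e').eq
  have hbc : b < c := by
    refine lt_of_le_of_ne (show closure {y} ⊆ Set.univ from Set.subset_univ _) fun e => hy ?_
    have e' : closure {y} = Set.univ := congrArg TopologicalSpace.IrreducibleCloseds.carrier e
    have hg : closure {genericPoint X} = (Set.univ : Set X) := genericPoint_closure X
    exact (inseparable_iff_closure_eq.2 (e'.trans hg.symm)).eq
  let p : LTSeries (TopologicalSpace.IrreducibleCloseds X) :=
    { length := 2
      toFun := ![a, b, c]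
      step := by
        intro i
        fin_cases i
        · exact hab
        · exact hbc }
  have h2 : ((2 : ℕ) : WithBot ℕ∞) ≤ topologicalKrullDim X := Order.LTSeries.length_le_krullDim p
  rw [hX] at h2
  exact absurd h2 (by decide)

/-- A nonconstant morphism of curves sends the generic point to the generic point. -/
theorem map_genericPoint [IsCurve C] [IsCurve D] (φ : C ⟶ D) [hφ : Nonconstant φ] :
    φ.left (genericPoint C.left) = genericPoint D.left := by
  by_contra hne
  refine hφ.not_constant ⟨φ.left (genericPoint C.left), fun x => ?_⟩
  exact eq_of_specializes IsCurve.dim_eq_one hne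
    ((genericPoint_specializes x).map φ.left.continuous)

/-- The homomorphism `K(D) → K(C)`, `f ↦ f ∘ φ`, induced by a nonconstant morphism of curves. -/
def functionFieldHom [IsCurve C] [IsCurve D] (φ : C ⟶ D) [Nonconstant φ] :
    D.left.functionField →+* C.left.functionField :=
  (D.left.presheaf.stalkSpecializes (specializes_of_eq (map_genericPoint φ)) ≫
    φ.left.stalkMap (genericPoint C.left)).hom

/-- The function field `K(C)` of the source of `φ : C ⟶ D`, regarded as an extension of `K(D)` by
means of `φ`. -/
def ExtensionField [IsCurve C] (_φ : C ⟶ D) : Type u := C.left.functionField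

instance [IsCurve C] (φ : C ⟶ D) : Field (ExtensionField φ) :=
  inferInstanceAs (Field C.left.functionField)

instance [IsCurve C] [IsCurve D] (φ : C ⟶ D) [Nonconstant φ] :
    Algebra D.left.functionField (ExtensionField φ) :=
  (functionFieldHom φ).toAlgebra

/-- A cover of curves: a nonconstant separable morphism. -/
class IsCover [IsCurve C] [IsCurve D] (φ : C ⟶ D) : Prop extends Nonconstant φ where
  separable : Algebra.IsSeparable D.left.functionField (ExtensionField φ)

/-- The degree `[K(C) : K(D)]` of a nonconstant morphism of curves. -/
def degree [IsCurve C] [IsCurve D] (φ : C ⟶ D) [Nonconstant φ] : ℕ :=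
  Module.finrank D.left.functionField (ExtensionField φ)

/-- A cover is decomposable if it is the composition of two covers, of curves over `K`, which both
have degree at least two. -/
def IsDecomposable [IsCurve C] [IsCurve D] (φ : C ⟶ D) : Prop :=
  ∃ (B : Over (Spec (.of K))) (_ : IsCurve B) (φ₁ : C ⟶ B) (φ₂ : B ⟶ D)
    (_ : IsCover φ₁) (_ : IsCover φ₂), φ₁ ≫ φ₂ = φ ∧ 2 ≤ degree φ₁ ∧ 2 ≤ degree φ₂

/-- A cover is indecomposable if it has degree at least two and is not decomposable. -/
def IsIndecomposable [IsCurve C] [IsCurve D] (φ : C ⟶ D) [IsCover φ] : Prop :=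
  2 ≤ degree φ ∧ ¬ IsDecomposable φ

/-- The group `Aut(φ)` of automorphisms `σ` of `C`, defined over `K`, such that `φ ∘ σ = φ`. -/
def autGroup (φ : C ⟶ D) : Subgroup (Aut C) where
  carrier := {σ | σ.hom ≫ φ = φ}
  one_mem' := Category.id_comp φ
  mul_mem' := by
    intro σ τ (hσ : σ.hom ≫ φ = φ) (hτ : τ.hom ≫ φ = φ)
    change (τ.hom ≫ σ.hom) ≫ φ = φ
    rw [Category.assoc, hσ, hτ]
  inv_mem' := by
    intro σ (hσ : σ.hom ≫ φ = φ)
    exact (Iso.inv_comp_eq (show C ≅ C from σ)).2 hσ.symm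

end Covers

/-! ### Monodromy groups -/

section Monodromy

/-- The Galois group over `F` of the Galois closure of `E / F` inside the algebraic closure of `F`
(the compositum of the images of all `F`-embeddings of `E`). -/
abbrev GaloisClosureGroup (F E : Type u) [Field F] [Field E] [Algebra F E] : Type u :=
  Gal(IntermediateField.normalClosure F E (AlgebraicClosure F) / F)

/-- The set of embeddings of `E` over `F` into the algebraic closure of `F`. -/
abbrev Embeddings (F E : Type u) [Field F] [Field E] [Algebra F E] : Type u :=
  E →ₐ[F] AlgebraicClosure F

/-- The Galois group of the Galois closure acts on the embeddings by composition, since every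
embedding takes its values in the Galois closure. -/
instance (F E : Type u) [Field F] [Field E] [Algebra F E] :
    MulAction (GaloisClosureGroup F E) (Embeddings F E) where
  smul σ f := normalClosure.algHomEquiv F E (AlgebraicClosure F)
    (σ.toAlgHom.comp ((normalClosure.algHomEquiv F E (AlgebraicClosure F)).symm f))
  one_smul _ := rfl
  mul_smul _ _ _ := rfl

variable {K : Type u} [Field K] {C D : Over (Spec (.of K))}

/-- The monodromy group `Mon(φ)`: the Galois group of the Galois closure of `K(C) / K(D)`. -/
abbrev monodromyGroup [IsCurve C] [IsCurve D] (φ : C ⟶ D) [IsCover φ] : Type u :=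
  GaloisClosureGroup D.left.functionField (ExtensionField φ)

/-- The set of embeddings of `K(C)` into the algebraic closure of `K(D)` over `K(D)`, on which
`Mon(φ)` acts. -/
abbrev embeddings [IsCurve C] [IsCurve D] (φ : C ⟶ D) [IsCover φ] : Type u :=
  Embeddings D.left.functionField (ExtensionField φ)

/-- The group `G` acts regularly on `X`: transitively, with trivial point stabilizers. -/
def IsRegularAction (G X : Type*) [Group G] [MulAction G X] : Prop :=
  MulAction.IsPretransitive G X ∧ ∀ x : X, MulAction.stabilizer G x = ⊥

end Monodromy

end CurveCover

end

/-! ### Galois theory of an extension without proper intermediate fields -/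

namespace CurveCover

section FieldTheory

variable {F E : Type u} [Field F] [Field E] [Algebra F E]

local notation "N[" F "," E "]" => IntermediateField.normalClosure F E (AlgebraicClosure F)

/-! Put `F = K(D)` and `E = K(C)`. Two bridges turn the theorem into field theory: an indecomposable
cover leaves no field strictly between `F` and `E` (`IsIndecomposable.eq_bot_or_eq_top`), and
`Aut(φ)` is the opposite of `Gal(E/F)` (`autGroupEquiv`).

The field theory is `tfae_of_forall_intermediateField`. Each of the last three conditions makes
`E/F` Galois. If the monodromy group is abelian, the subgroup fixing a copy of `E` is normal; if it
acts regularly, that subgroup is a point stabilizer, hence trivial; if `Gal(E/F)` is nontrivial, its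
fixed field is not `E`, so it is `F`. Once `E/F` is Galois, it is its own Galois closure, and its
group has no proper nontrivial subgroup, so it is cyclic of prime order.

Both bridges rest on one lifting principle, `exists_lift_of_isIntegralHom`: a nonconstant `φ` is
finite (`isFinite_left`), and `C` is normal, so `C` is the normalization of `D` in `E` and inherits
its universal property. Lifting along `φ` itself realizes field automorphisms by automorphisms of
`C`. Lifting along the normalization `B` of `D` in an intermediate field `L` gives `C ⟶ B ⟶ D` with
degrees `[E : L]` and `[L : F]` (`exists_factorization`).

It remains to see that `B` is a curve (`isCurve_normalizationCurve`). Its affine charts are Dedekind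
because integral closures of Dedekind domains are, and it is geometrically irreducible as an image
of `C`. For projectivity, an ample line bundle is replaced by an `AmpleFamily` of rational
functions: `D` has one, it pulls back along `B ⟶ D`, and high powers of its members, together with
multiples by chart generators, embed `B` into projective space. -/

theorem mem_stabilizer_iff_mem_fixingSubgroup
    (σ : GaloisClosureGroup F E) (f : E →ₐ[F] N[F, E]) :
    σ ∈ MulAction.stabilizer (GaloisClosureGroup F E)
      (normalClosure.algHomEquiv F E (AlgebraicClosure F) f) ↔
      σ ∈ f.fieldRange.fixingSubgroup := by
  rw [MulAction.mem_stabilizer_iff, IntermediateField.mem_fixingSubgroup_iff]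
  change normalClosure.algHomEquiv F E (AlgebraicClosure F) (σ.toAlgHom.comp
    ((normalClosure.algHomEquiv F E (AlgebraicClosure F)).symm
      (normalClosure.algHomEquiv F E (AlgebraicClosure F) f))) = _ ↔ _
  rw [Equiv.apply_eq_iff_eq, Equiv.symm_apply_apply, DFunLike.ext_iff]
  simp only [AlgHom.mem_fieldRange, forall_exists_index, forall_apply_eq_imp_iff]
  rfl

/-- Moving `f x` to `g x` defines an embedding of the image of `f` into the normal closure, and
normality extends it to an automorphism. -/
theorem exists_galoisClosureGroup_smul_eq [FiniteDimensional F E] (f g : Embeddings F E) :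
    ∃ σ : GaloisClosureGroup F E, σ • f = g := by
  obtain ⟨f, rfl⟩ := (normalClosure.algHomEquiv F E (AlgebraicClosure F)).surjective f
  obtain ⟨g, rfl⟩ := (normalClosure.algHomEquiv F E (AlgebraicClosure F)).surjective g
  let e : f.fieldRange →ₐ[F] N[F, E] :=
    g.comp (AlgEquiv.ofInjectiveField f).symm.toAlgHom
  refine ⟨AlgEquiv.ofBijective (e.liftNormal N[F, E])
    (Algebra.IsAlgebraic.algHom_bijective _), ?_⟩
  change normalClosure.algHomEquiv F E (AlgebraicClosure F) (AlgHom.comp _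
    ((normalClosure.algHomEquiv F E (AlgebraicClosure F)).symm
      (normalClosure.algHomEquiv F E (AlgebraicClosure F) f))) = _
  rw [Equiv.apply_eq_iff_eq, Equiv.symm_apply_apply]
  ext x
  have h := e.liftNormal_commutes N[F, E] (AlgEquiv.ofInjectiveField f x)
  have h' : e (AlgEquiv.ofInjectiveField f x) = g x :=
    congrArg g ((AlgEquiv.ofInjectiveField f).symm_apply_apply x)
  rw [h'] at h
  exact congrArg Subtype.val h

theorem isGalois_of_fieldRange_eq_top [IsGalois F N[F, E]] (f : E →ₐ[F] N[F, E])
    (hf : f.fieldRange = ⊤) : IsGalois F E :=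
  IsGalois.of_algEquiv (AlgEquiv.ofBijective f
    ⟨f.injective, AlgHom.fieldRange_eq_top.1 hf⟩).symm

/-- All embeddings of a normal extension have the same image, so the compositum of the images is any
one of them. -/
theorem fieldRange_eq_top_of_isGalois [IsGalois F E] (f : E →ₐ[F] N[F, E]) :
    f.fieldRange = ⊤ := by
  rw [AlgHom.fieldRange_eq_top]
  rintro ⟨y, hy⟩
  have : N[F, E] ≤ ((N[F, E]).val.comp f).fieldRange := by
    rw [normalClosure_le_iff]
    intro g
    rintro _ ⟨x, rfl⟩
    let h := (N[F, E]).val.comp f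
    have : Normal F h.fieldRange := Normal.of_algEquiv (AlgEquiv.ofInjectiveField h)
    let g' : h.fieldRange →ₐ[F] AlgebraicClosure F :=
      g.comp (AlgEquiv.ofInjectiveField h).symm.toAlgHom
    have hg : g'.fieldRange = h.fieldRange := AlgHom.fieldRange_of_normal g'
    exact hg.le ⟨AlgEquiv.ofInjectiveField h x,
      congrArg g ((AlgEquiv.ofInjectiveField h).symm_apply_apply x)⟩
  obtain ⟨x, hx⟩ := this hy
  exact ⟨x, Subtype.ext hx⟩

theorem isGalois_of_monodromy_comm [FiniteDimensional F E] [Algebra.IsSeparable F E]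
    [IsGalois F N[F, E]] (f : E →ₐ[F] N[F, E])
    (h : ∀ σ τ : GaloisClosureGroup F E, σ * τ = τ * σ) : IsGalois F E := by
  -- Commutativity is used only here: every subgroup is normal, and the fixed field of a normal
  -- subgroup is Galois over the base.
  have : f.fieldRange.fixingSubgroup.Normal :=
    ⟨fun n hn g => by rwa [h g n, mul_inv_cancel_right]⟩
  have hg : IsGalois F (IntermediateField.fixedField f.fieldRange.fixingSubgroup) :=
    IsGalois.of_fixedField_normal_subgroup _
  rw [IsGalois.fixedField_fixingSubgroup] at hg
  let e : E ≃ₐ[F] f.fieldRange := AlgEquiv.ofInjectiveField f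
  exact IsGalois.of_algEquiv e.symm

theorem isGalois_of_monodromy_regular [FiniteDimensional F E]
    [IsGalois F N[F, E]] (f : E →ₐ[F] N[F, E])
    (h : IsRegularAction (GaloisClosureGroup F E) (Embeddings F E)) : IsGalois F E := by
  refine isGalois_of_fieldRange_eq_top f ?_
  rw [← IsGalois.fixedField_fixingSubgroup f.fieldRange]
  have : f.fieldRange.fixingSubgroup = ⊥ := by
    rw [← h.2 (normalClosure.algHomEquiv F E (AlgebraicClosure F) f)]
    ext σ
    exact (mem_stabilizer_iff_mem_fixingSubgroup σ f).symm
  rw [this, IntermediateField.fixedField_bot]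

theorem monodromy_regular_of_isGalois [FiniteDimensional F E] [IsGalois F E] :
    IsRegularAction (GaloisClosureGroup F E) (Embeddings F E) := by
  refine ⟨⟨exists_galoisClosureGroup_smul_eq⟩, fun f => ?_⟩
  obtain ⟨f, rfl⟩ := (normalClosure.algHomEquiv F E (AlgebraicClosure F)).surjective f
  ext σ
  rw [mem_stabilizer_iff_mem_fixingSubgroup, fieldRange_eq_top_of_isGalois f,
    IntermediateField.fixingSubgroup_top]

theorem isSimpleOrder_subgroup_gal [FiniteDimensional F E] [IsGalois F E]
    (h2 : 2 ≤ Module.finrank F E) (hL : ∀ L : IntermediateField F E, L = ⊥ ∨ L = ⊤) :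
    IsSimpleOrder (Subgroup Gal(E/F)) := by
  have hcard := IsGalois.card_aut_eq_finrank F E
  have : Nontrivial Gal(E/F) := by
    rw [← Finite.one_lt_card_iff_nontrivial]
    omega
  refine ⟨fun H => ?_⟩
  rw [← IntermediateField.fixingSubgroup_fixedField H]
  rcases hL (IntermediateField.fixedField H) with h | h
  · right
    rw [h, IntermediateField.fixingSubgroup_bot]
  · left
    rw [h, IntermediateField.fixingSubgroup_top]

/-- Any nontrivial element generates the group, so it is commutative and simple. -/
theorem isCyclic_and_prime_card_of_isSimpleOrder {G : Type*} [Group G]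
    [h : IsSimpleOrder (Subgroup G)] : IsCyclic G ∧ (Nat.card G).Prime := by
  have : Nontrivial G := Subgroup.nontrivial_iff.1 inferInstance
  obtain ⟨g, hg⟩ := exists_ne (1 : G)
  have hz : Subgroup.zpowers g = ⊤ :=
    (eq_bot_or_eq_top (Subgroup.zpowers g)).resolve_left (Subgroup.zpowers_ne_bot.2 hg)
  have hc : IsCyclic G := ⟨⟨g, (Subgroup.eq_top_iff' _).1 hz⟩⟩
  let _ : CommGroup G := IsCyclic.commGroup
  have : IsSimpleGroup G := ⟨fun H _ => eq_bot_or_eq_top H⟩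
  exact ⟨hc, IsSimpleGroup.prime_card⟩

/-- The equivalences for an extension without proper intermediate fields. -/
theorem tfae_of_forall_intermediateField [FiniteDimensional F E] [Algebra.IsSeparable F E]
    (h2 : 2 ≤ Module.finrank F E) (hL : ∀ L : IntermediateField F E, L = ⊥ ∨ L = ⊤)
    {A : Type*} [Group A] (e : A ≃* (Gal(E/F))ᵐᵒᵖ) :
    List.TFAE [
      (Module.finrank F E).Prime ∧
        (IsCyclic A ∧ Nat.card A = Module.finrank F E) ∧
        (IsCyclic (GaloisClosureGroup F E) ∧
          Nat.card (GaloisClosureGroup F E) = Module.finrank F E),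
      ∀ σ τ : GaloisClosureGroup F E, σ * τ = τ * σ,
      IsRegularAction (GaloisClosureGroup F E) (Embeddings F E),
      1 < ENat.card A] := by
  let f : E →ₐ[F] N[F, E] :=
    (normalClosure.algHomEquiv F E (AlgebraicClosure F)).symm IsAlgClosed.lift
  -- The normal closure is a compositum of copies of `E`, each separable.
  have hsep : Algebra.IsSeparable F N[F, E] := by
    have : ∀ g : E →ₐ[F] AlgebraicClosure F, Algebra.IsSeparable F g.fieldRange := fun g =>
      Algebra.IsSeparable.of_algHom F E (AlgEquiv.ofInjectiveField g).symm.toAlgHom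
    rw [IntermediateField.normalClosure]
    infer_instance
  have hN : IsGalois F N[F, E] := ⟨⟩
  have key : IsGalois F E → ((Module.finrank F E).Prime ∧
        (IsCyclic A ∧ Nat.card A = Module.finrank F E) ∧
        (IsCyclic (GaloisClosureGroup F E) ∧
          Nat.card (GaloisClosureGroup F E) = Module.finrank F E)) := by
    intro hg
    have := isSimpleOrder_subgroup_gal h2 hL
    obtain ⟨hc, hp⟩ := isCyclic_and_prime_card_of_isSimpleOrder (G := Gal(E/F))
    have hcard := IsGalois.card_aut_eq_finrank F E
    let eN : E ≃ₐ[F] N[F, E] := AlgEquiv.ofBijective f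
      ⟨f.injective, AlgHom.fieldRange_eq_top.1 (fieldRange_eq_top_of_isGalois f)⟩
    let eG : Gal(E/F) ≃* GaloisClosureGroup F E := eN.autCongr
    let _ : CommGroup Gal(E/F) := IsCyclic.commGroup
    -- Inversion identifies a group with its opposite.
    let eA : A ≃* Gal(E/F) := e.trans (MulEquiv.inv' Gal(E/F)).symm
    refine ⟨hcard ▸ hp, ⟨isCyclic_of_surjective eA.symm eA.symm.surjective, ?_⟩,
      isCyclic_of_surjective eG eG.surjective, ?_⟩
    · rw [Nat.card_congr eA.toEquiv, hcard]
    · rw [← Nat.card_congr eG.toEquiv, hcard]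
  tfae_have 1 → 2 := by
    rintro ⟨-, -, h, -⟩ σ τ
    let _ : CommGroup (GaloisClosureGroup F E) := IsCyclic.commGroup
    exact mul_comm σ τ
  tfae_have 2 → 3 := fun h =>
    have := isGalois_of_monodromy_comm f h
    monodromy_regular_of_isGalois
  tfae_have 3 → 1 := fun h => key (isGalois_of_monodromy_regular f h)
  tfae_have 1 → 4 := by
    rintro ⟨hp, ⟨-, hA⟩, -⟩
    have : Finite A := Nat.finite_of_card_ne_zero (hA ▸ hp.ne_zero)
    rw [ENat.card_eq_coe_natCard, hA]
    exact_mod_cast hp.one_lt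
  tfae_have 4 → 1 := by
    intro h
    -- If the fixed field of the whole group were `E`, the Galois correspondence would make the
    -- group trivial.
    refine key (IsGalois.of_fixedField_eq_bot F E ((hL _).resolve_right fun ht => ?_))
    rw [ENat.one_lt_card_iff_nontrivial] at h
    have : Nontrivial Gal(E/F) :=
      (e.toEquiv.trans MulOpposite.opEquiv.symm).nontrivial_congr.1 h
    have h1 := IntermediateField.fixingSubgroup_fixedField (⊤ : Subgroup Gal(E/F))
    rw [ht, IntermediateField.fixingSubgroup_top] at h1
    exact bot_ne_top h1
  tfae_finish

end FieldTheory
end CurveCover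

/-! ### Affine charts of a curve are Dedekind -/

namespace CurveCover

section Dedekind

variable {X : Scheme.{u}}

/-- By regularity the cotangent space has dimension equal to the Krull dimension, at most one; this
is the tangent space criterion for a valuation ring. -/
theorem isDiscreteValuationRing_of_isRegularLocalRing (R : Type*) [CommRing R] [IsDomain R]
    [IsRegularLocalRing R] [Ring.DimensionLEOne R] (h : ¬ IsField R) :
    IsDiscreteValuationRing R := by
  have h1 : ringKrullDim R ≤ (1 : ℕ) := Ring.krullDimLE_iff.1 inferInstance
  rw [← (IsRegularLocalRing.iff_finrank_cotangentSpace R).1 inferInstance] at h1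
  have h1 : Module.finrank (IsLocalRing.ResidueField R) (IsLocalRing.CotangentSpace R) ≤ 1 := by
    exact_mod_cast h1
  have h2 : Module.finrank (IsLocalRing.ResidueField R) (IsLocalRing.CotangentSpace R) ≠ 0 :=
    fun h0 => h (IsLocalRing.finrank_cotangentSpace_eq_zero_iff.1 h0)
  exact ((IsDiscreteValuationRing.TFAE R h).out 0 5).2 (by omega)

/-- A nonzero prime is a non-generic point, which has no proper specialization, so it equals any
maximal ideal above it. -/
theorem dimensionLEOne_of_isAffineOpen [IsIntegral X] (hX : topologicalKrullDim X = 1)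
    {U : X.Opens} (hU : IsAffineOpen U) [Nonempty U] : Ring.DimensionLEOne Γ(X, U) := by
  refine ⟨fun {p} hp hpp => ?_⟩
  obtain ⟨m, hm, hpm⟩ := p.exists_le_maximal hpp.ne_top
  let x : PrimeSpectrum Γ(X, U) := ⟨p, hpp⟩
  let y : PrimeSpectrum Γ(X, U) := ⟨m, hm.isPrime⟩
  have hinj : Function.Injective hU.fromSpec := hU.fromSpec.isOpenEmbedding.injective
  have hxy : hU.fromSpec x ⤳ hU.fromSpec y :=
    ((PrimeSpectrum.le_iff_specializes x y).1 hpm).map hU.fromSpec.continuous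
  have hx : hU.fromSpec x ≠ genericPoint X := fun h => hp <| by
    rw [← genericPoint_eq_of_isOpenImmersion hU.fromSpec, genericPoint_eq_bot_of_affine] at h
    exact congrArg PrimeSpectrum.asIdeal (hinj h)
  have := hinj (eq_of_specializes hX hx hxy)
  have : p = m := (congrArg PrimeSpectrum.asIdeal this).symm
  rwa [this]

theorem isDedekindDomain_of_isAffineOpen [IsIntegral X] [IsLocallyNoetherian X]
    (hX : topologicalKrullDim X = 1) (hreg : ∀ x : X, IsRegularLocalRing (X.presheaf.stalk x))
    {U : X.Opens} (hU : IsAffineOpen U) [Nonempty U] : IsDedekindDomain Γ(X, U) := by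
  have := dimensionLEOne_of_isAffineOpen hX hU
  have : IsNoetherianRing Γ(X, U) := IsLocallyNoetherian.component_noetherian ⟨U, hU⟩
  have : IsDedekindDomainDvr Γ(X, U) := by
    refine ⟨fun P hP hPP => ?_⟩
    let x : PrimeSpectrum Γ(X, U) := ⟨P, hPP⟩
    let _ := TopCat.Presheaf.algebra_section_stalk X.presheaf
      ⟨hU.fromSpec x, hU.opensRange_fromSpec.le ⟨x, rfl⟩⟩
    have hx : IsLocalization.AtPrime (X.presheaf.stalk (hU.fromSpec x)) P :=
      hU.isLocalization_stalk' x (hU.opensRange_fromSpec.le ⟨x, rfl⟩)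
    have := hreg (hU.fromSpec x)
    have : IsRegularLocalRing (Localization.AtPrime P) :=
      IsRegularLocalRing.of_ringEquiv
        (IsLocalization.algEquiv P.primeCompl (X.presheaf.stalk (hU.fromSpec x))
          (Localization.AtPrime P)).toRingEquiv
    have : Ring.DimensionLEOne (Localization.AtPrime P) :=
      Ring.DimensionLEOne.localization _ P.primeCompl_le_nonZeroDivisors
    exact isDiscreteValuationRing_of_isRegularLocalRing _
      (IsLocalization.AtPrime.not_isField _ hP _)
  infer_instance

end Dedekind

/-! ### Properness of curves and finiteness of nonconstant morphisms -/

section Proper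

variable {K : Type u} [Field K]

attribute [local instance] MvPolynomial.gradedAlgebra

instance (n : ℕ) : IsProper (projectiveSpace K n).hom := by
  -- `Proj` is proper over its degree-zero part, which for polynomials is just `K`.
  have : Function.Bijective
      (algebraMap K (MvPolynomial.homogeneousSubmodule (Fin (n + 1)) K 0)) := by
    refine ⟨fun a b h => MvPolynomial.C_injective (Fin (n + 1)) K (congrArg Subtype.val h),
      fun ⟨p, hp⟩ => ?_⟩
    rw [MvPolynomial.homogeneousSubmodule_zero] at hp
    obtain ⟨c, hc⟩ := Submodule.mem_one.1 hp
    exact ⟨c, Subtype.ext hc⟩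
  have : IsIso (CommRingCat.ofHom
      (algebraMap K (MvPolynomial.homogeneousSubmodule (Fin (n + 1)) K 0))) :=
    (ConcreteCategory.isIso_iff_bijective _).2 this
  have : IsScalarTower K (MvPolynomial.homogeneousSubmodule (Fin (n + 1)) K 0)
      (MvPolynomial (Fin (n + 1)) K) :=
    ⟨fun a b c => smul_assoc a (b : MvPolynomial (Fin (n + 1)) K) c⟩
  have : Algebra.FiniteType (MvPolynomial.homogeneousSubmodule (Fin (n + 1)) K 0)
      (MvPolynomial (Fin (n + 1)) K) := .of_restrictScalars_finiteType K _ _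
  dsimp [projectiveSpace]
  infer_instance

variable {C D : Over (Spec (.of K))}

theorem isProper_hom (C : Over (Spec (.of K))) [IsCurve C] : IsProper C.hom := by
  obtain ⟨n, i, hi⟩ := IsCurve.projective (C := C)
  rw [← Over.w i]
  infer_instance

theorem isLocallyNoetherian_left (C : Over (Spec (.of K))) [IsCurve C] :
    IsLocallyNoetherian C.left :=
  have := isProper_hom C
  LocallyOfFiniteType.isLocallyNoetherian C.hom

theorem isProper_left [IsCurve C] [IsCurve D] (φ : C ⟶ D) : IsProper φ.left := by
  have := isProper_hom C
  have := isProper_hom D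
  have : IsProper (φ.left ≫ D.hom) := by rwa [Over.w]
  exact .of_comp _ D.hom

theorem closure_singleton_of_ne_genericPoint [IsCurve C] {x : C.left}
    (hx : x ≠ genericPoint C.left) : closure {x} = {x} := by
  ext y
  rw [← specializes_iff_mem_closure, Set.mem_singleton_iff]
  exact ⟨eq_of_specializes IsCurve.dim_eq_one hx, fun h => h ▸ specializes_rfl⟩

theorem exists_ne_genericPoint [IsCurve C] : ∃ x : C.left, x ≠ genericPoint C.left := by
  by_contra! h
  have : Subsingleton C.left := ⟨fun x y => (h x).trans (h y).symm⟩
  have h0 := topologicalKrullDim_zero_of_discreteTopology C.left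
  rw [IsCurve.dim_eq_one (C := C)] at h0
  exact absurd h0 (by decide)

/-- A proper morphism with finite fibres is finite. -/
theorem isFinite_left [IsCurve C] [IsCurve D] (φ : C ⟶ D) [Nonconstant φ] :
    IsFinite φ.left := by
  have := isProper_left φ
  have := isLocallyNoetherian_left C
  have := isProper_hom C
  have : IsNoetherian C.left := { 
    toCompactSpace := (quasiCompact_iff_compactSpace C.hom).1 inferInstance }
  -- The image of a closed point is closed, whereas a closed generic point would make `D` a single
  -- point.
  have hgen : ∀ x : C.left, x ≠ genericPoint C.left → φ.left x ≠ genericPoint D.left := by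
    intro x hx h
    have h1 := φ.left.isClosedMap _ (isClosed_closure (s := {x}))
    rw [closure_singleton_of_ne_genericPoint hx, Set.image_singleton, h] at h1
    obtain ⟨y, hy⟩ := exists_ne_genericPoint (C := D)
    refine hy ?_
    have := genericPoint_specializes y
    rw [specializes_iff_mem_closure, h1.closure_eq] at this
    exact this
  have : LocallyQuasiFinite φ.left := by
    refine .of_finite_preimage_singleton _ fun y => ?_
    by_cases hy : y = genericPoint D.left
    · refine (Set.finite_singleton (genericPoint C.left)).subset fun x hx => ?_
      by_contra h
      exact hgen x h (hx.trans hy)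
    -- The fibre is a finite union of irreducible closed sets. None contains the generic point of
    -- `C`, so each is one closed point.
    · have hcl : IsClosed (φ.left ⁻¹' {y}) := by
        rw [← closure_singleton_of_ne_genericPoint hy]
        exact isClosed_closure.preimage φ.left.continuous
      obtain ⟨S, hS, hScl, hirr, hSU⟩ :=
        TopologicalSpace.NoetherianSpace.exists_finite_set_isClosed_irreducible hcl
      rw [hSU]
      refine hS.sUnion fun Z hZ => ?_
      let z := (hirr Z hZ).genericPoint
      have hz : closure {z} = Z := (hirr Z hZ).isGenericPoint_genericPoint (hScl Z hZ)
      have hzy : φ.left z = y :=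
        hSU.ge (Set.mem_sUnion_of_mem (hz.le (subset_closure rfl)) hZ)
      rw [← hz, closure_singleton_of_ne_genericPoint]
      · exact Set.finite_singleton z
      · rintro h
        rw [h, map_genericPoint] at hzy
        exact hy hzy.symm
  exact .of_isProper_of_locallyQuasiFinite _

end Proper
end CurveCover

/-! ### Morphisms of integral schemes and their function fields -/

namespace CurveCover

section FunctionFieldMap

variable {X Y : Scheme.{u}} [IsIntegral X] [IsIntegral Y]

/-- The inclusion of the generic point of an integral scheme. -/
noncomputable abbrev genericInclusion (X : Scheme.{u}) [IsIntegral X] :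
    Spec X.functionField ⟶ X :=
  X.fromSpecStalk (genericPoint X)

instance (X : Scheme.{u}) [IsIntegral X] : IsDominant (genericInclusion X) := by
  refine ⟨?_⟩
  rw [DenseRange, Scheme.range_fromSpecStalk]
  refine Dense.mono (s₁ := {genericPoint X}) ?_ (dense_iff_closure_eq.2 (genericPoint_closure X))
  rintro _ rfl
  exact specializes_rfl

/-- The map on function fields induced by a morphism of integral schemes that preserves
generic points. -/
noncomputable def functionFieldMap (f : X ⟶ Y) (hf : f (genericPoint X) = genericPoint Y) :
    Y.functionField ⟶ X.functionField :=
  Y.presheaf.stalkSpecializes (specializes_of_eq hf) ≫ f.stalkMap (genericPoint X)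

theorem map_functionFieldMap_genericInclusion (f : X ⟶ Y)
    (hf : f (genericPoint X) = genericPoint Y) :
    Spec.map (functionFieldMap f hf) ≫ genericInclusion Y = genericInclusion X ≫ f := by
  rw [functionFieldMap, Spec.map_comp, Category.assoc,
    Scheme.SpecMap_stalkSpecializes_fromSpecStalk, Scheme.SpecMap_stalkMap_fromSpecStalk]

/-- The inclusion of the generic point is a monomorphism, so a map of function fields is determined
by its composite with it. -/
theorem functionFieldMap_eq_of_map_genericInclusion {f : X ⟶ Y}
    (hf : f (genericPoint X) = genericPoint Y) {i : Y.functionField ⟶ X.functionField}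
    (hi : Spec.map i ≫ genericInclusion Y = genericInclusion X ≫ f) :
    functionFieldMap f hf = i := by
  rw [← map_functionFieldMap_genericInclusion f hf, cancel_mono] at hi
  exact (Spec.map_injective hi).symm

theorem germToFunctionField_functionFieldMap (f : X ⟶ Y)
    (hf : f (genericPoint X) = genericPoint Y) (U : Y.Opens) [Nonempty U] [Nonempty (f ⁻¹ᵁ U)] :
    Y.germToFunctionField U ≫ functionFieldMap f hf =
      f.app U ≫ X.germToFunctionField (f ⁻¹ᵁ U) := by
  simp [functionFieldMap, Scheme.germToFunctionField]

theorem nonempty_preimage (f : X ⟶ Y) (hf : f (genericPoint X) = genericPoint Y)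
    (U : Y.Opens) [h : Nonempty U] : Nonempty (f ⁻¹ᵁ U) := by
  refine ⟨⟨genericPoint X, ?_⟩⟩
  change f (genericPoint X) ∈ U
  rw [hf]
  exact ((genericPoint_spec Y).mem_open_set_iff U.isOpen).2 (by simpa using h)

/-- An element of `A` comes from some `q` in `Q`; its integral equation transfers to `q` because `θ`
is injective, and `R` is integrally closed. -/
theorem bijective_of_isIntegral_of_birational {R A Q Q' : Type*} [CommRing R] [IsDomain R]
    [IsIntegrallyClosed R] [Field Q] [Algebra R Q] [IsFractionRing R Q] [CommRing A] [Field Q']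
    (f : R →+* A) (h : A →+* Q') (θ : Q →+* Q') (hcomm : ∀ r, θ (algebraMap R Q r) = h (f r))
    (hh : Function.Injective h) (hθ : Function.Surjective θ) (hf : f.IsIntegral) :
    Function.Bijective f := by
  refine ⟨fun a b hab => ?_, fun a => ?_⟩
  · apply IsFractionRing.injective R Q
    apply θ.injective
    rw [hcomm, hcomm, hab]
  · obtain ⟨q, hq⟩ := hθ (h a)
    obtain ⟨p, hp, hpa⟩ := hf a
    have hqi : IsIntegral R q := by
      refine ⟨p, hp, θ.injective ?_⟩
      have hc : θ.comp (algebraMap R Q) = h.comp f := RingHom.ext hcomm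
      rw [map_zero, Polynomial.hom_eval₂, hc, hq, ← Polynomial.hom_eval₂, hpa, map_zero]
    obtain ⟨r, hr⟩ := IsIntegrallyClosed.isIntegral_iff.1 hqi
    exact ⟨r, hh (by rw [← hcomm, hr, hq])⟩

/-- A birational integral morphism onto an integral scheme with integrally closed sections is
an isomorphism. -/
theorem isIso_of_birational (f : X ⟶ Y) [IsIntegralHom f]
    (hf : f (genericPoint X) = genericPoint Y)
    (hs : Function.Surjective (functionFieldMap f hf))
    (hY : ∀ U : Y.Opens, IsAffineOpen U → Nonempty U → IsIntegrallyClosed Γ(Y, U)) :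
    IsIso f := by
  suffices h : ∀ U : Y.affineOpens, IsIso (f.app U.1) by
    refine (IsZariskiLocalAtTarget.iff_of_iSup_eq_top (P := .isomorphisms _) _
      (iSup_affineOpens_eq_top Y)).2 fun U => ?_
    exact (isIso_morphismRestrict_iff_isIso_app f (U := U.1) U.2).2 (h U)
  rintro ⟨U, hU : IsAffineOpen U⟩
  change IsIso (f.app U)
  rw [ConcreteCategory.isIso_iff_bijective]
  by_cases hne : Nonempty U
  · have := nonempty_preimage f hf U
    have := hY U hU hne
    have := functionField_isFractionRing_of_isAffineOpen Y U hU
    exact bijective_of_isIntegral_of_birational (Q := Y.functionField) (Q' := X.functionField)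
      (f.app U).hom (X.germToFunctionField (f ⁻¹ᵁ U)).hom (functionFieldMap f hf).hom
      (fun r => ConcreteCategory.congr_hom (germToFunctionField_functionFieldMap f hf U) r)
      (X.germToFunctionField_injective (f ⁻¹ᵁ U)) hs (f.isIntegral_app U hU)
  · have : U = ⊥ := by
      ext x
      simpa using fun hx => hne ⟨x, hx⟩
    subst this
    have : Subsingleton Γ(Y, ⊥) := inferInstance
    have : Subsingleton Γ(X, f ⁻¹ᵁ ⊥) := inferInstanceAs (Subsingleton Γ(X, ⊥))
    exact ⟨Function.injective_of_subsingleton _, fun b => ⟨0, Subsingleton.elim _ _⟩⟩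

/-- The spectrum of a field has one point, so density forces its image to be the generic point and
`t` factors through the stalk there. -/
theorem exists_map_genericInclusion_eq {L : Type u} [Field L] (t : Spec (.of L) ⟶ Y)
    [IsDominant t] : ∃ θ : Y.functionField ⟶ .of L, Spec.map θ ≫ genericInclusion Y = t := by
  have h : t (IsLocalRing.closedPoint L) = genericPoint Y := by
    refine ((genericPoint_spec Y).eq ?_).symm
    have : Set.range t = {t (IsLocalRing.closedPoint L)} := by
      ext y
      constructor
      · rintro ⟨x, rfl⟩
        exact congrArg t (Subsingleton.elim (α := PrimeSpectrum L) _ _)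
      · rintro rfl
        exact ⟨_, rfl⟩
    have h := t.denseRange.closure_range
    rwa [this] at h
  refine ⟨Y.presheaf.stalkSpecializes (specializes_of_eq h) ≫
    Scheme.stalkClosedPointTo (R := .of L) t, ?_⟩
  rw [Spec.map_comp, Category.assoc, Scheme.SpecMap_stalkSpecializes_fromSpecStalk]
  exact Scheme.Spec_stalkClosedPointTo_fromSpecStalk t

theorem germToFunctionField_comp_of_map_genericInclusion {L : Type u} [Field L]
    {t : Spec (.of L) ⟶ Y} {θ : Y.functionField ⟶ .of L}
    (h : Spec.map θ ≫ genericInclusion Y = t) (U : Y.Opens) [Nonempty U] (hU : ⊤ ≤ t ⁻¹ᵁ U) :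
    Y.germToFunctionField U ≫ θ = t.appLE U ⊤ hU ≫ (Scheme.ΓSpecIso (.of L)).hom := by
  subst h
  have hη : genericPoint Y ∈ U :=
    ((genericPoint_spec Y).mem_open_set_iff U.isOpen).2 (by simpa using ‹Nonempty U›)
  have hj : ⊤ ≤ genericInclusion Y ⁻¹ᵁ U := by
    rintro x -
    rw [Subsingleton.elim (α := PrimeSpectrum Y.functionField) x (IsLocalRing.closedPoint _)]
    change genericInclusion Y (IsLocalRing.closedPoint _) ∈ U
    rwa [Scheme.fromSpecStalk_closedPoint]
  rw [← Scheme.Hom.appLE_comp_appLE _ _ U ⊤ ⊤ hj le_top, Scheme.Hom.appLE,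
    Scheme.fromSpecStalk_app hη]
  simp only [Category.assoc, ← Functor.map_comp_assoc]
  rw [Subsingleton.elim (_ ≫ _) (𝟙 _), CategoryTheory.Functor.map_id, Category.id_comp]
  have h3 : (Spec.map θ).appLE ⊤ ⊤ le_top = (Spec.map θ).appTop := by
    exact Category.comp_id _
  rw [h3, Scheme.ΓSpecIso_naturality, Iso.inv_hom_id_assoc]

end FunctionFieldMap

end CurveCover

/-! ### Normalization in an extension of the function field -/

namespace CurveCover

section Normalization

theorem exists_toNormalization_appLE_eq {X Y : Scheme.{u}} (f : X ⟶ Y) [QuasiCompact f]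
    [QuasiSeparated f] {U : Y.Opens} (hU : IsAffineOpen U) {a : Γ(X, f ⁻¹ᵁ U)}
    (ha : (f.app U).hom.IsIntegralElem a)
    (h : f ⁻¹ᵁ U ≤ f.toNormalization ⁻¹ᵁ f.fromNormalization ⁻¹ᵁ U) :
    ∃ b, f.toNormalization.appLE (f.fromNormalization ⁻¹ᵁ U) (f ⁻¹ᵁ U) h b = a := by
  let _ := (f.app U).hom.toAlgebra
  refine ⟨(f.normalizationObjIso hU).inv ⟨a, ha⟩, ?_⟩
  have h3 := (Iso.eq_inv_comp _).2 (f.normalizationObjIso_hom_val hU)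
  exact (ConcreteCategory.congr_hom h3 _).symm

variable {X : Scheme.{u}} [IsIntegral X] {L : Type u} [Field L]

/-- The morphism from the spectrum of an extension of the function field. -/
noncomputable abbrev fieldPoint (i : X.functionField ⟶ .of L) : Spec (.of L) ⟶ X :=
  Spec.map i ≫ genericInclusion X

variable (i : X.functionField ⟶ .of L)

theorem fieldPoint_apply (x : Spec (.of L)) : fieldPoint i x = genericPoint X :=
  (congrArg (genericInclusion X) (Subsingleton.elim (α := PrimeSpectrum X.functionField)
    (Spec.map i x) (IsLocalRing.closedPoint _))).trans Scheme.fromSpecStalk_closedPoint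

theorem genericPoint_of_fieldPoint_comp {X Y : Scheme.{u}} [IsIntegral X] [IsIntegral Y]
    {j : X.functionField ⟶ .of L} {k : Y.functionField ⟶ .of L} (f : X ⟶ Y)
    (h : fieldPoint j ≫ f = fieldPoint k) : f (genericPoint X) = genericPoint Y := by
  obtain ⟨x⟩ : Nonempty (Spec (.of L)) := inferInstance
  rw [← fieldPoint_apply j x, ← Scheme.Hom.comp_apply, h, fieldPoint_apply]

theorem le_fieldPoint_preimage (U : X.Opens) [Nonempty U] : ⊤ ≤ fieldPoint i ⁻¹ᵁ U := by
  have hη : genericPoint X ∈ U :=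
    ((genericPoint_spec X).mem_open_set_iff U.isOpen).2 (by simpa using ‹Nonempty U›)
  rintro x -
  change fieldPoint i x ∈ U
  rwa [fieldPoint_apply]

theorem le_toNormalization_preimage (U : X.Opens) [Nonempty U] :
    ⊤ ≤ (fieldPoint i).toNormalization ⁻¹ᵁ (fieldPoint i).fromNormalization ⁻¹ᵁ U := by
  rw [← Scheme.Hom.comp_preimage, Scheme.Hom.toNormalization_fromNormalization]
  exact le_fieldPoint_preimage i U

/-- Elements of `L` integral over `Γ(X, U)` are regular functions on the normalization; this is its
construction as a relative integral closure, read inside `L`. -/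
theorem exists_appLE_toNormalization_eq {U : X.Opens} (hU : IsAffineOpen U) [Nonempty U]
    {l : L} (hl : (i.hom.comp (X.germToFunctionField U).hom).IsIntegralElem l) :
    ∃ b : Γ((fieldPoint i).normalization, (fieldPoint i).fromNormalization ⁻¹ᵁ U),
      (Scheme.ΓSpecIso (.of L)).hom ((fieldPoint i).toNormalization.appLE _ ⊤
        (le_toNormalization_preimage i U) b) = l := by
  let g := fieldPoint i
  have hle : ⊤ ≤ g ⁻¹ᵁ U := le_fieldPoint_preimage i U
  let _ := (g.app U).hom.toAlgebra
  -- The preimage of `U` is all of `Spec L`, so its sections are a copy of `L`.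
  let m : CommRingCat.of L ⟶ Γ(Spec (.of L), g ⁻¹ᵁ U) :=
    (Scheme.ΓSpecIso (.of L)).inv ≫ (Spec (.of L)).presheaf.map (homOfLE le_top).op
  have hm : X.germToFunctionField U ≫ i ≫ m = g.app U := by
    have h : X.germToFunctionField U ≫ i = g.appLE U ⊤ hle ≫ (Scheme.ΓSpecIso (.of L)).hom :=
      germToFunctionField_comp_of_map_genericInclusion rfl U hle
    rw [reassoc_of% h, Iso.hom_inv_id_assoc, Scheme.Hom.appLE_map, Scheme.Hom.app_eq_appLE]
  have ha : (g.app U).hom.IsIntegralElem (m.hom l) := by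
    obtain ⟨p, hp, hpl⟩ := hl
    refine ⟨p, hp, ?_⟩
    have h2 : (g.app U).hom =
      m.hom.comp (i.hom.comp (X.germToFunctionField U).hom) := congrArg CommRingCat.Hom.hom hm.symm
    rw [h2, ← Polynomial.hom_eval₂, hpl, map_zero]
  have hle' : g ⁻¹ᵁ U ≤ g.toNormalization ⁻¹ᵁ g.fromNormalization ⁻¹ᵁ U := by
    rw [← Scheme.Hom.comp_preimage, g.toNormalization_fromNormalization]
  obtain ⟨b, hb⟩ := exists_toNormalization_appLE_eq g hU ha hle'
  refine ⟨b, ?_⟩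
  rw [← Scheme.Hom.appLE_map _ hle' (homOfLE hle).op, CommRingCat.comp_apply, hb]
  have h5 : m ≫ (Spec (.of L)).presheaf.map (homOfLE hle).op ≫ (Scheme.ΓSpecIso (.of L)).hom =
      𝟙 _ := by
    simp only [m, Category.assoc]
    rw [← Functor.map_comp_assoc]
    exact (congrArg (fun x => (Scheme.ΓSpecIso (.of L)).inv ≫ x ≫ (Scheme.ΓSpecIso (.of L)).hom)
      (CategoryTheory.Functor.map_id _ _)).trans (Iso.inv_hom_id _)
  exact ConcreteCategory.congr_hom h5 l

/-- The function field of the normalization of `X` in an extension of the function field. -/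
noncomputable def normalizationFunctionField :
    (fieldPoint i).normalization.functionField ⟶ .of L :=
  (exists_map_genericInclusion_eq (fieldPoint i).toNormalization).choose

theorem map_normalizationFunctionField :
    Spec.map (normalizationFunctionField i) ≫ genericInclusion _ =
      (fieldPoint i).toNormalization :=
  (exists_map_genericInclusion_eq (fieldPoint i).toNormalization).choose_spec

theorem fromNormalization_genericPoint :
    (fieldPoint i).fromNormalization (genericPoint (fieldPoint i).normalization) =
      genericPoint X := by
  refine genericPoint_of_fieldPoint_comp (j := normalizationFunctionField i) (k := i) _ ?_
  exact (congrArg (· ≫ (fieldPoint i).fromNormalization) (map_normalizationFunctionField i)).trans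
    (Scheme.Hom.toNormalization_fromNormalization _)

theorem functionFieldMap_fromNormalization :
    functionFieldMap (fieldPoint i).fromNormalization (fromNormalization_genericPoint i) ≫
      normalizationFunctionField i = i := by
  apply Spec.map_injective
  rw [← cancel_mono (genericInclusion X), Spec.map_comp, Category.assoc,
    map_functionFieldMap_genericInclusion, ← Category.assoc, map_normalizationFunctionField,
    Scheme.Hom.toNormalization_fromNormalization]

theorem germToFunctionField_comp_normalizationFunctionField (U : X.Opens) [Nonempty U]
    [Nonempty ((fieldPoint i).fromNormalization ⁻¹ᵁ U)] :
    (fieldPoint i).normalization.germToFunctionField ((fieldPoint i).fromNormalization ⁻¹ᵁ U) ≫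
      normalizationFunctionField i =
    (fieldPoint i).toNormalization.appLE _ ⊤ (le_toNormalization_preimage i U) ≫
      (Scheme.ΓSpecIso (.of L)).hom :=
  germToFunctionField_comp_of_map_genericInclusion (map_normalizationFunctionField i) _ _

theorem normalizationFunctionField_surjective (hi : i.hom.IsIntegral) :
    Function.Surjective (normalizationFunctionField i) := by
  intro l
  obtain ⟨_, ⟨U, hU, rfl⟩, hη, -⟩ := X.isBasis_affineOpens.exists_subset_of_mem_open
    (Set.mem_univ (genericPoint X)) isOpen_univ
  have hU : IsAffineOpen U := hU
  have : Nonempty U := ⟨⟨_, hη⟩⟩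
  have := nonempty_preimage (fieldPoint i).fromNormalization (fromNormalization_genericPoint i) U
  have := functionField_isFractionRing_of_isAffineOpen X U hU
  let _ : Algebra X.functionField L := i.hom.toAlgebra
  let _ : Algebra Γ(X, U) L := (i.hom.comp (X.germToFunctionField U).hom).toAlgebra
  have : IsScalarTower Γ(X, U) X.functionField L := .of_algebraMap_eq' rfl
  -- Clearing denominators: some multiple `r • l` is integral over the chart, hence a regular
  -- function on the normalization, and `l` is its quotient by `r`.
  obtain ⟨⟨r, hr⟩, hrl⟩ := IsIntegral.exists_multiple_integral_of_isLocalization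
    (nonZeroDivisors Γ(X, U)) l (Rₘ := X.functionField) (hi l)
  obtain ⟨b, hb⟩ := exists_appLE_toNormalization_eq i hU hrl
  have h1 := (ConcreteCategory.congr_hom
    (germToFunctionField_comp_normalizationFunctionField i U) b).trans hb
  have h2 := ConcreteCategory.congr_hom (functionFieldMap_fromNormalization i)
    (X.germToFunctionField U r)
  have hr0 : i (X.germToFunctionField U r) ≠ 0 := by
    have h0 : algebraMap Γ(X, U) X.functionField r ≠ 0 :=
      IsFractionRing.to_map_ne_zero_of_mem_nonZeroDivisors hr
    exact (map_ne_zero i.hom).2 h0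
  refine ⟨(fieldPoint i).normalization.germToFunctionField _ b /
    functionFieldMap _ (fromNormalization_genericPoint i) (X.germToFunctionField U r), ?_⟩
  refine (map_div₀ (normalizationFunctionField i).hom _ _).trans ?_
  refine (congrArg₂ (· / ·) h1 h2).trans ?_
  exact mul_div_cancel_left₀ l hr0

end Normalization

end CurveCover

/-! ### From Dedekind charts back to regularity and dimension one -/

namespace CurveCover

section DedekindScheme

variable {X : Scheme.{u}} [IsIntegral X]

theorem isRegularLocalRing_stalk_of_isDedekindDomain {U : X.Opens} (hU : IsAffineOpen U)
    {x : X} (hx : x ∈ U) (hD : IsDedekindDomain Γ(X, U)) :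
    IsRegularLocalRing (X.presheaf.stalk x) := by
  let P := (hU.primeIdealOf ⟨x, hx⟩).asIdeal
  let _ := TopCat.Presheaf.algebra_section_stalk X.presheaf (⟨x, hx⟩ : U)
  have hP : IsLocalization.AtPrime (X.presheaf.stalk x) P := hU.isLocalization_stalk ⟨x, hx⟩
  have : Nonempty U := ⟨⟨x, hx⟩⟩
  have : IsDedekindDomain (X.presheaf.stalk x) :=
    IsLocalization.AtPrime.isDedekindDomain Γ(X, U) P _
  -- A Dedekind domain with finitely many maximal ideals is principal, and a local principal ideal
  -- domain is regular.
  have : IsPrincipalIdealRing (X.presheaf.stalk x) :=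
    IsPrincipalIdealRing.of_finite_maximals <| (Set.finite_singleton
      (IsLocalRing.maximalIdeal (X.presheaf.stalk x))).subset
        fun I (hI : I.IsMaximal) => IsLocalRing.eq_maximalIdeal hI
  infer_instance

theorem eq_of_specializes_of_dimensionLEOne {U : X.Opens} (hU : IsAffineOpen U)
    [h : Ring.DimensionLEOne Γ(X, U)] {x y : X} (hx : x ≠ genericPoint X) (hy : y ∈ U)
    (hxy : x ⤳ y) : x = y := by
  have hxU : x ∈ U := hxy.mem_open U.isOpen hy
  have : Nonempty U := ⟨⟨x, hxU⟩⟩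
  let p : PrimeSpectrum Γ(X, U) := hU.primeIdealOf ⟨x, hxU⟩
  let q : PrimeSpectrum Γ(X, U) := hU.primeIdealOf ⟨y, hy⟩
  have hp : hU.fromSpec p = x := hU.fromSpec_primeIdealOf ⟨x, hxU⟩
  have hq : hU.fromSpec q = y := hU.fromSpec_primeIdealOf ⟨y, hy⟩
  have hpq : p ≤ q := by
    rw [PrimeSpectrum.le_iff_specializes]
    rw [← hp, ← hq] at hxy
    exact hU.fromSpec.isOpenEmbedding.isInducing.specializes_iff.1 hxy
  have hp0 : p.asIdeal ≠ ⊥ := fun h0 => hx <| by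
    rw [← hp, ← genericPoint_eq_of_isOpenImmersion hU.fromSpec, genericPoint_eq_bot_of_affine]
    exact congrArg hU.fromSpec (PrimeSpectrum.ext h0)
  have := (h.maximalOfPrime hp0 p.isPrime).eq_of_le q.isPrime.ne_top hpq
  rw [← hp, ← hq, PrimeSpectrum.ext this]

/-- An irreducible closed set is either the whole space or the closure of a non-generic point, which
is minimal; the point `x` rules out dimension zero. -/
theorem topologicalKrullDim_eq_one
    (hX : ∀ x : X, ∃ U : X.Opens, x ∈ U ∧ IsAffineOpen U ∧ Ring.DimensionLEOne Γ(X, U))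
    {x : X} (hx : x ≠ genericPoint X) : topologicalKrullDim X = 1 := by
  refine le_antisymm (Order.krullDim_le_one_iff.2 fun Z => ?_) (Order.one_le_krullDim_iff.2 ?_)
  · let z := Z.isIrreducible.genericPoint
    have hz : closure {z} = (Z : Set X) := Z.isIrreducible.isGenericPoint_genericPoint Z.isClosed
    by_cases h : z = genericPoint X
    · right
      intro Z' _ y _
      change y ∈ (Z : Set X)
      rw [← hz, h, genericPoint_closure]
      trivial
    · left
      intro Z' hZ'
      let z' := Z'.isIrreducible.genericPoint
      have hz' : closure {z'} = (Z' : Set X) :=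
        Z'.isIrreducible.isGenericPoint_genericPoint Z'.isClosed
      obtain ⟨U, hU, hUa, hUd⟩ := hX z'
      have hs : z ⤳ z' := by
        rw [specializes_iff_mem_closure, hz]
        exact hZ' (hz'.le (subset_closure rfl))
      have := eq_of_specializes_of_dimensionLEOne hUa h hU hs
      change (Z : Set X) ⊆ Z'
      rw [← hz, ← hz', this]
  · refine ⟨⟨closure {x}, isIrreducible_singleton.closure, isClosed_closure⟩,
      ⟨Set.univ, IrreducibleSpace.isIrreducible_univ X, isClosed_univ⟩,
      lt_of_le_of_ne (Set.subset_univ _) fun h => hx ?_⟩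
    have h' : closure {x} = Set.univ := congrArg TopologicalSpace.IrreducibleCloseds.carrier h
    exact (inseparable_iff_closure_eq.2 (h'.trans (genericPoint_closure X).symm)).eq

end DedekindScheme

/-! ### Normalization in a finite separable extension is finite and Dedekind -/

section NormalizationDedekind

variable {X : Scheme.{u}} [IsIntegral X] {L : Type u} [Field L] [Algebra X.functionField L]
  [FiniteDimensional X.functionField L] [Algebra.IsSeparable X.functionField L]

variable (X L) in
/-- The morphism from the spectrum of a finite extension of the function field. -/
noncomputable abbrev extensionPoint : Spec (.of L) ⟶ X :=
  fieldPoint (CommRingCat.ofHom (algebraMap X.functionField L))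

theorem isDedekindDomain_and_finite {U : X.Opens} (hU : IsAffineOpen U) [Nonempty U]
    (hD : IsDedekindDomain Γ(X, U)) :
    IsDedekindDomain Γ((extensionPoint X L).normalization,
      (extensionPoint X L).fromNormalization ⁻¹ᵁ U) ∧
    ((extensionPoint X L).fromNormalization.app U).hom.Finite := by
  let i : X.functionField ⟶ .of L := CommRingCat.ofHom (algebraMap X.functionField L)
  let B := (extensionPoint X L).normalization
  let π : B ⟶ X := (extensionPoint X L).fromNormalization
  have hπ : π (genericPoint B) = genericPoint X := fromNormalization_genericPoint i
  have : Nonempty (π ⁻¹ᵁ U) := nonempty_preimage π hπ U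
  have := functionField_isFractionRing_of_isAffineOpen X U hU
  let ψ : Γ(B, π ⁻¹ᵁ U) ⟶ .of L :=
    B.germToFunctionField (π ⁻¹ᵁ U) ≫ normalizationFunctionField i
  have hψ : Function.Injective ψ := fun a b h => B.germToFunctionField_injective (π ⁻¹ᵁ U)
    ((normalizationFunctionField i).hom.injective h)
  have hcomm : π.app U ≫ ψ = X.germToFunctionField U ≫ i := by
    rw [← functionFieldMap_fromNormalization i, ← Category.assoc, ← Category.assoc,
      germToFunctionField_functionFieldMap]
  let _ : Algebra Γ(X, U) Γ(B, π ⁻¹ᵁ U) := (π.app U).hom.toAlgebra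
  let _ : Algebra Γ(B, π ⁻¹ᵁ U) L := ψ.hom.toAlgebra
  let _ : Algebra Γ(X, U) L := (i.hom.comp (X.germToFunctionField U).hom).toAlgebra
  have : IsScalarTower Γ(X, U) X.functionField L := .of_algebraMap_eq' rfl
  have : IsScalarTower Γ(X, U) Γ(B, π ⁻¹ᵁ U) L :=
    .of_algebraMap_eq' (congrArg CommRingCat.Hom.hom hcomm).symm
  -- Once the sections are known to be the integral closure in `L`, the classical theorems for
  -- finite separable extensions of Dedekind domains apply.
  have : IsIntegralClosure Γ(B, π ⁻¹ᵁ U) Γ(X, U) L := by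
    refine ⟨hψ, fun {l} => ⟨fun hl => ?_, ?_⟩⟩
    · obtain ⟨b, hb⟩ := exists_appLE_toNormalization_eq i hU hl
      exact ⟨b, (ConcreteCategory.congr_hom
        (germToFunctionField_comp_normalizationFunctionField i U) b).trans hb⟩
    · rintro ⟨b, rfl⟩
      have hb : IsIntegral Γ(X, U) b := π.isIntegral_app U hU b
      exact hb.algebraMap
  have : IsDomain Γ(B, π ⁻¹ᵁ U) := inferInstance
  exact ⟨IsIntegralClosure.isDedekindDomain Γ(X, U) X.functionField L _,
    IsIntegralClosure.finite Γ(X, U) X.functionField L _⟩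

theorem isFinite_fromNormalization
    (hX : ∀ U : X.Opens, IsAffineOpen U → Nonempty U → IsDedekindDomain Γ(X, U)) :
    IsFinite (extensionPoint X L).fromNormalization := by
  refine { finite_app := fun U hU => ?_ }
  by_cases hne : Nonempty U
  · exact (isDedekindDomain_and_finite hU (hX U hU hne)).2
  · have : U = ⊥ := by
      ext x
      simpa using fun hx => hne ⟨x, hx⟩
    subst this
    let f := (extensionPoint X L).fromNormalization
    have : Subsingleton Γ((extensionPoint X L).normalization, f ⁻¹ᵁ ⊥) :=
      inferInstanceAs (Subsingleton Γ((extensionPoint X L).normalization, ⊥))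
    exact RingHom.Finite.of_surjective _ fun b => ⟨0, Subsingleton.elim _ _⟩

theorem exists_isDedekindDomain_normalization
    (hX : ∀ U : X.Opens, IsAffineOpen U → Nonempty U → IsDedekindDomain Γ(X, U))
    (x : (extensionPoint X L).normalization) :
    ∃ U, x ∈ U ∧ IsAffineOpen U ∧ IsDedekindDomain Γ((extensionPoint X L).normalization, U) := by
  let π := (extensionPoint X L).fromNormalization
  obtain ⟨_, ⟨U, hU, rfl⟩, hη, -⟩ := X.isBasis_affineOpens.exists_subset_of_mem_open
    (Set.mem_univ (π x)) isOpen_univ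
  have hU : IsAffineOpen U := hU
  have : Nonempty U := ⟨⟨_, hη⟩⟩
  exact ⟨π ⁻¹ᵁ U, hη, hU.preimage π, (isDedekindDomain_and_finite hU (hX U hU this)).1⟩

end NormalizationDedekind

/-! ### The lifting principle for nonconstant morphisms of curves -/

section Lift

variable {K : Type u} [Field K] {C D : Over (Spec (.of K))} [IsCurve C] [IsCurve D]

theorem isDedekindDomain_of_isCurve (C : Over (Spec (.of K))) [IsCurve C] (U : C.left.Opens)
    (hU : IsAffineOpen U) (_ : Nonempty U) : IsDedekindDomain Γ(C.left, U) :=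
  have := isLocallyNoetherian_left C
  isDedekindDomain_of_isAffineOpen IsCurve.dim_eq_one IsCurve.nonsingular hU

/-- The source of a nonconstant morphism of curves is the normalization of the target in
its function field. -/
theorem exists_lift_of_isIntegralHom (φ : C ⟶ D) [Nonconstant φ] {T : Scheme.{u}}
    (q : T ⟶ D.left) [IsIntegralHom q] (h : Spec C.left.functionField ⟶ T)
    (hh : h ≫ q = genericInclusion C.left ≫ φ.left) :
    ∃ s : C.left ⟶ T, s ≫ q = φ.left ∧ genericInclusion C.left ≫ s = h := by
  have := isFinite_left φ
  let i : D.left.functionField ⟶ .of C.left.functionField :=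
    functionFieldMap φ.left (map_genericPoint φ)
  have hi : fieldPoint i = genericInclusion C.left ≫ φ.left :=
    map_functionFieldMap_genericInclusion φ.left (map_genericPoint φ)
  let c := (fieldPoint i).normalizationDesc (genericInclusion C.left) φ.left hi
  let s := (fieldPoint i).normalizationDesc h q (hi.trans hh.symm)
  have htc : (fieldPoint i).toNormalization ≫ c = genericInclusion C.left :=
    Scheme.Hom.toNormalization_normalizationDesc ..
  have hc : c (genericPoint _) = genericPoint C.left := by
    refine genericPoint_of_fieldPoint_comp (L := C.left.functionField)
      (j := normalizationFunctionField i) (k := 𝟙 _) c ?_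
    have h1 : fieldPoint (normalizationFunctionField i) = (fieldPoint i).toNormalization :=
      map_normalizationFunctionField i
    have h2 : Spec.map (𝟙 C.left.functionField) ≫ genericInclusion C.left =
        genericInclusion C.left := by
      rw [Spec.map_id]
      exact Category.id_comp _
    rw [h1, htc]
    exact h2.symm
  -- The comparison map `c` from the normalization of `D` in `K(C)` to `C` is integral and
  -- birational, and `C` is normal.
  have : IsIso c := by
    refine isIso_of_birational c hc ?_ fun U hU hne =>
      have := isDedekindDomain_of_isCurve C U hU hne
      inferInstance
    have hcomp : functionFieldMap c hc ≫ normalizationFunctionField i = 𝟙 _ := by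
      apply Spec.map_injective
      rw [← cancel_mono (genericInclusion C.left), Spec.map_comp, Category.assoc,
        map_functionFieldMap_genericInclusion, ← Category.assoc, map_normalizationFunctionField,
        htc, Spec.map_id]
      exact (Category.id_comp _).symm
    intro a
    refine ⟨normalizationFunctionField i a, (normalizationFunctionField i).hom.injective ?_⟩
    exact ConcreteCategory.congr_hom hcomp _
  refine ⟨inv c ≫ s, ?_, ?_⟩
  · rw [Category.assoc, IsIso.inv_comp_eq, Scheme.Hom.normalizationDesc_comp,
      Scheme.Hom.normalizationDesc_comp]
  · rw [← htc, Category.assoc, IsIso.hom_inv_id_assoc,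
      Scheme.Hom.toNormalization_normalizationDesc]

end Lift

end CurveCover

/-! ### Rational functions in place of an ample line bundle -/

namespace CurveCover

/-- A finite affine cover `U i` of an integral scheme together with rational functions `ξ i`, such
that `ξ k / ξ i` is regular on `U i` with nonvanishing locus `U i ∩ U k`. -/
structure AmpleFamily (X : Scheme.{u}) [IsIntegral X] where
  /-- The index type. -/
  ι : Type
  finite : Finite ι
  /-- The open sets of the cover. -/
  U : ι → X.Opens
  isAffineOpen : ∀ i, IsAffineOpen (U i)
  nonempty : ∀ i, Nonempty (U i)
  iSup_eq_top : ⨆ i, U i = ⊤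
  /-- The rational functions. -/
  ξ : ι → X.functionField
  ξ_ne_zero : ∀ i, ξ i ≠ 0
  /-- The quotients of the rational functions. -/
  u : ∀ i, ι → Γ(X, U i)
  germ_u : ∀ i k, X.germToFunctionField (U i) (u i k) = ξ k / ξ i
  basicOpen_u : ∀ i k, X.basicOpen (u i k) = U i ⊓ U k

/-- Pulling back an ample family along an affine dominant morphism. -/
noncomputable def AmpleFamily.comap {X Y : Scheme.{u}} [IsIntegral X] [IsIntegral Y]
    (a : AmpleFamily Y) (f : X ⟶ Y) [IsAffineHom f] (hf : f (genericPoint X) = genericPoint Y) :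
    AmpleFamily X where
  ι := a.ι
  finite := a.finite
  U i := f ⁻¹ᵁ a.U i
  isAffineOpen i := (a.isAffineOpen i).preimage f
  nonempty i := have := a.nonempty i; nonempty_preimage f hf (a.U i)
  iSup_eq_top := by
    rw [← Scheme.Hom.preimage_iSup, a.iSup_eq_top, Scheme.Hom.preimage_top]
  ξ i := functionFieldMap f hf (a.ξ i)
  ξ_ne_zero i := (map_ne_zero (functionFieldMap f hf).hom).2 (a.ξ_ne_zero i)
  u i k := f.app (a.U i) (a.u i k)
  germ_u i k := by
    have := a.nonempty i
    have := nonempty_preimage f hf (a.U i)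
    have h := ConcreteCategory.congr_hom
      (germToFunctionField_functionFieldMap f hf (a.U i)) (a.u i k)
    refine h.symm.trans ?_
    refine (congrArg (functionFieldMap f hf) (a.germ_u i k)).trans ?_
    exact map_div₀ (functionFieldMap f hf).hom _ _
  basicOpen_u i k := by
    rw [← Scheme.preimage_basicOpen, a.basicOpen_u, Scheme.Hom.preimage_inf]

/-! ### The ample family of a scheme affine over projective space -/

section Proj

variable {K : Type u} [Field K]

attribute [local instance] MvPolynomial.gradedAlgebra

open HomogeneousLocalization

variable (K) in
/-- The grading of the polynomial ring. -/
abbrev polyGrading (n : ℕ) : ℕ → Submodule K (MvPolynomial (Fin (n + 1)) K) :=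
  MvPolynomial.homogeneousSubmodule (Fin (n + 1)) K

theorem X_mem_polyGrading {n : ℕ} (i : Fin (n + 1)) :
    (MvPolynomial.X i : MvPolynomial (Fin (n + 1)) K) ∈ polyGrading K n 1 :=
  MvPolynomial.isHomogeneous_X K i

/-- The function `x k / x i` on the `i`-th standard chart of projective space. -/
noncomputable def coordinateQuotient {n : ℕ} (i k : Fin (n + 1)) :
    Away (polyGrading K n) (MvPolynomial.X i) :=
  Away.mk (polyGrading K n) (X_mem_polyGrading i) 1 (MvPolynomial.X k)
    (by simpa using X_mem_polyGrading k)

theorem awayToSection_germ_apply {n : ℕ} (j : Fin (n + 1)) (x : Proj (polyGrading K n))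
    (hj : x ∈ Proj.basicOpen (polyGrading K n) (MvPolynomial.X j))
    (z : Away (polyGrading K n) (MvPolynomial.X j)) :
    (Proj (polyGrading K n)).presheaf.germ _ x hj (Proj.awayToSection (polyGrading K n) _ z) =
      (Proj.stalkIso' (polyGrading K n) x).symm
        (mapId (polyGrading K n) (Submonoid.powers_le.mpr hj) z) :=
  ConcreteCategory.congr_hom (ProjectiveSpectrum.Proj.awayToSection_germ (polyGrading K n)
      (MvPolynomial.X j) x hj) z

theorem val_mapId_coordinateQuotient {n : ℕ} (i k : Fin (n + 1))
    (x : ProjectiveSpectrum (polyGrading K n))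
    (hi : MvPolynomial.X i ∈ x.asHomogeneousIdeal.toIdeal.primeCompl) :
    (mapId (polyGrading K n) (Submonoid.powers_le.mpr hi) (coordinateQuotient i k)).val =
      Localization.mk (MvPolynomial.X k)
        (⟨MvPolynomial.X i, hi⟩ : x.asHomogeneousIdeal.toIdeal.primeCompl) := by
  refine (congrArg HomogeneousLocalization.val (map_mk _ _ _)).trans ?_
  refine (HomogeneousLocalization.val_mk _).trans ?_
  refine congrArg₂ Localization.mk rfl (Subtype.ext ?_)
  exact pow_one _

/-- This cocycle relation is what lets all ratios be written as `ξ k / ξ i` with `ξ k = x k / x i₀`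
for one fixed `i₀`. -/
theorem germ_awayToSection_coordinateQuotient_mul {n : ℕ} (i k l : Fin (n + 1))
    (x : Proj (polyGrading K n))
    (hi : x ∈ Proj.basicOpen (polyGrading K n) (MvPolynomial.X i))
    (hk : x ∈ Proj.basicOpen (polyGrading K n) (MvPolynomial.X k)) :
    (Proj (polyGrading K n)).presheaf.germ _ x hi
        (Proj.awayToSection (polyGrading K n) _ (coordinateQuotient i k)) *
      (Proj (polyGrading K n)).presheaf.germ _ x hk
        (Proj.awayToSection (polyGrading K n) _ (coordinateQuotient k l)) =
      (Proj (polyGrading K n)).presheaf.germ _ x hi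
        (Proj.awayToSection (polyGrading K n) _ (coordinateQuotient i l)) := by
  refine (congrArg₂ (· * ·) (awayToSection_germ_apply i x hi (coordinateQuotient i k))
    (awayToSection_germ_apply k x hk (coordinateQuotient k l))).trans
    (Eq.trans ?_ (awayToSection_germ_apply i x hi (coordinateQuotient i l)).symm)
  refine (map_mul (Proj.stalkIso' (polyGrading K n) x).symm _ _).symm.trans (congrArg _ ?_)
  apply HomogeneousLocalization.val_injective
  refine (HomogeneousLocalization.val_mul _ _).trans ?_
  refine (congrArg₂ (· * ·) (val_mapId_coordinateQuotient i k x hi)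
    (val_mapId_coordinateQuotient k l x hk)).trans
    (Eq.trans ?_ (val_mapId_coordinateQuotient i l x hi).symm)
  refine (Localization.mk_mul _ _ _ _).trans ?_
  rw [Localization.mk_eq_mk_iff, Localization.r_iff_exists]
  refine ⟨1, ?_⟩
  simp only [OneMemClass.coe_one, one_mul, Submonoid.coe_mul]
  ring

theorem basicOpen_awayToSection_coordinateQuotient {n : ℕ} (i k : Fin (n + 1)) :
    (Proj (polyGrading K n)).basicOpen
      (Proj.awayToSection (polyGrading K n) (MvPolynomial.X i) (coordinateQuotient i k)) =
      Proj.basicOpen (polyGrading K n) (MvPolynomial.X i) ⊓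
        Proj.basicOpen (polyGrading K n) (MvPolynomial.X k) := by
  ext x
  rw [SetLike.mem_coe, SetLike.mem_coe, Scheme.mem_basicOpen'', TopologicalSpace.Opens.mem_inf]
  refine Iff.trans (exists_congr fun hi => ?_) exists_prop
  have hp : x.asHomogeneousIdeal.toIdeal.IsPrime := ProjectiveSpectrum.isPrime x
  refine (iff_of_eq (congrArg IsUnit
    (awayToSection_germ_apply i x hi (coordinateQuotient i k)))).trans ?_
  refine (MulEquiv.isUnit_map (Proj.stalkIso' (polyGrading K n) x).symm).trans ?_
  refine (HomogeneousLocalization.isUnit_iff_isUnit_val _ _ _).symm.trans ?_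
  refine (iff_of_eq (congrArg IsUnit (val_mapId_coordinateQuotient i k x hi))).trans ?_
  rw [Localization.mk_eq_mk']
  refine (IsLocalization.AtPrime.isUnit_mk'_iff _ x.asHomogeneousIdeal.toIdeal _ _).trans ?_
  exact Iff.rfl

theorem exists_ampleFamily {n : ℕ} {X : Scheme.{u}} [IsIntegral X]
    (f : X ⟶ Proj (polyGrading K n)) [IsAffineHom f] : Nonempty (AmpleFamily X) := by
  let P := Proj (polyGrading K n)
  let V (i : Fin (n + 1)) : P.Opens := Proj.basicOpen (polyGrading K n) (MvPolynomial.X i)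
  let t (i k : Fin (n + 1)) : Γ(P, V i) := Proj.awayToSection (polyGrading K n) _
    (coordinateQuotient i k)
  have hbasic (i k) : P.basicOpen (t i k) = V i ⊓ V k :=
    basicOpen_awayToSection_coordinateQuotient i k
  have htop : ⨆ i, V i = ⊤ := Proj.iSup_basicOpen_eq_top' _ _ (fun i => ⟨1, X_mem_polyGrading i⟩)
    (by
      rw [eq_top_iff]
      intro p _
      induction p using MvPolynomial.induction_on with
      | C a => exact Subalgebra.algebraMap_mem _ (⟨MvPolynomial.C a,
          MvPolynomial.isHomogeneous_C _ a⟩ : polyGrading K n 0)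
      | add p q hp hq => exact add_mem (hp trivial) (hq trivial)
      | mul_X p i hp => exact mul_mem (hp trivial) (Algebra.subset_adjoin ⟨i, rfl⟩))
  have hftop : ⨆ i, f ⁻¹ᵁ V i = ⊤ := by
    rw [← Scheme.Hom.preimage_iSup, htop, Scheme.Hom.preimage_top]
  let w (i k : Fin (n + 1)) : Γ(X, f ⁻¹ᵁ V i) := f.app (V i) (t i k)
  have hw (i k) : X.basicOpen (w i k) = f ⁻¹ᵁ V i ⊓ f ⁻¹ᵁ V k := by
    change X.basicOpen (f.app (V i) (t i k)) = _
    rw [← Scheme.preimage_basicOpen, hbasic, Scheme.Hom.preimage_inf]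
  obtain ⟨i₀, hi₀⟩ : ∃ i, genericPoint X ∈ f ⁻¹ᵁ V i := by
    have : genericPoint X ∈ ⨆ i, f ⁻¹ᵁ V i := hftop ▸ trivial
    exact TopologicalSpace.Opens.mem_iSup.1 this
  have hmem (i) (hi : Nonempty ↥(f ⁻¹ᵁ V i)) : genericPoint X ∈ f ⁻¹ᵁ V i :=
    ((genericPoint_spec X).mem_open_set_iff (f ⁻¹ᵁ V i).isOpen).2
      (by obtain ⟨x⟩ := hi; exact ⟨x, trivial, x.2⟩)
  let γ (i k) (hi : genericPoint X ∈ f ⁻¹ᵁ V i) : X.functionField :=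
    X.presheaf.germ _ (genericPoint X) hi (w i k)
  have hγ (i k l) (hi) (hk) : γ i k hi * γ k l hk = γ i l hi := by
    have hg (j m) (hj) : γ j m hj = f.stalkMap (genericPoint X)
        (P.presheaf.germ _ (f (genericPoint X)) hj (t j m)) :=
      (ConcreteCategory.congr_hom (f.germ_stalkMap (V j) (genericPoint X) hj) (t j m)).symm
    rw [hg, hg, hg, ← map_mul]
    exact congrArg _ (germ_awayToSection_coordinateQuotient_mul i k l (f (genericPoint X)) hi hk)
  have hγ1 (i hi) : γ i i hi = 1 := by
    have hu : genericPoint X ∈ X.basicOpen (w i i) := by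
      rw [hw]
      exact ⟨hi, hi⟩
    -- By the cocycle relation `γ i i` is idempotent; being a unit, it is one.
    obtain ⟨_, hu⟩ := (Scheme.mem_basicOpen'' X _ _).1 hu
    exact (mul_eq_left₀ hu.ne_zero).1 (hγ i i i hi hi)
  have hne (k : Fin (n + 1)) (hk : Nonempty ↥(f ⁻¹ᵁ V k)) : γ i₀ k hi₀ ≠ 0 := by
    intro h0
    have := hγ k i₀ k (hmem k hk) hi₀
    rw [h0, mul_zero, hγ1] at this
    exact zero_ne_one this
  exact ⟨{
    -- Charts that miss the image of `X` are dropped, since their coordinates need not give nonzero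
    -- functions.
    ι := {i : Fin (n + 1) // Nonempty ↥(f ⁻¹ᵁ V i)}
    finite := inferInstance
    U := fun i => f ⁻¹ᵁ V i
    isAffineOpen := fun i => (Proj.isAffineOpen_basicOpen (polyGrading K n) _
      (X_mem_polyGrading i.1) one_pos).preimage f
    nonempty := fun i => i.2
    iSup_eq_top := by
      rw [eq_top_iff, ← hftop]
      refine iSup_le fun i x hx => ?_
      exact TopologicalSpace.Opens.mem_iSup.2 ⟨⟨i, ⟨⟨x, hx⟩⟩⟩, hx⟩
    ξ := fun k => γ i₀ k hi₀
    ξ_ne_zero := fun k => hne k.1 k.2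
    u := fun i k => w i k
    germ_u := fun i k => by
      rw [eq_div_iff (hne i.1 i.2), mul_comm]
      exact hγ i₀ i k hi₀ (hmem i.1 i.2)
    basicOpen_u := fun i k => hw i k }⟩

end Proj

end CurveCover

/-! ### Points of `Proj` with given homogeneous coordinates -/

namespace CurveCover

section ProjectivePoint

open HomogeneousLocalization

variable {K A : Type u} [CommRing K] [CommRing A] [Algebra K A] (𝒜 : ℕ → Submodule K A)
  [GradedAlgebra 𝒜] {R S : Type u} [CommRing R] [CommRing S]

/-- The homomorphism from a chart of `Proj` induced by a homomorphism `g` from the homogeneous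
coordinate ring such that `g t` is a unit. -/
noncomputable def chartHom (g : A →+* R) {t : A} (ht : IsUnit (g t)) : Away 𝒜 t →+* R :=
  (Localization.awayLift g t ht).comp (algebraMap (Away 𝒜 t) (Localization.Away t))

theorem chartHom_mk_mul (g : A →+* R) {t : A} (ht : IsUnit (g t)) {d : ℕ} (hd : t ∈ 𝒜 d) (n : ℕ)
    (a : A) (ha : a ∈ 𝒜 (n • d)) : chartHom 𝒜 g ht (Away.mk 𝒜 hd n a ha) * g t ^ n = g a := by
  have h : (algebraMap (Away 𝒜 t) (Localization.Away t)) (Away.mk 𝒜 hd n a ha) *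
      algebraMap A _ (t ^ n) = algebraMap A _ a := by
    rw [HomogeneousLocalization.algebraMap_apply, Away.val_mk, Localization.mk_eq_mk']
    exact IsLocalization.mk'_spec (Localization.Away t) a (⟨t ^ n, n, rfl⟩ : Submonoid.powers t)
  have h' := congrArg (Localization.awayLift g t ht) h
  rw [map_mul] at h'
  refine (congrArg₂ (· * ·) rfl ?_).trans (h'.trans (IsLocalization.Away.lift_eq t ht a))
  exact ((IsLocalization.Away.lift_eq t ht (t ^ n)).trans (map_pow g t n)).symm

theorem chartHom_mk (g : A →+* R) {t : A} (ht : g t = 1) {d : ℕ} (hd : t ∈ 𝒜 d) (n : ℕ)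
    (a : A) (ha : a ∈ 𝒜 (n • d)) :
    chartHom 𝒜 g (ht ▸ isUnit_one) (Away.mk 𝒜 hd n a ha) = g a := by
  have hu : IsUnit (g t) := ht ▸ isUnit_one
  have h := chartHom_mk_mul 𝒜 g hu hd n a ha
  have h1 : chartHom 𝒜 g hu (Away.mk 𝒜 hd n a ha) * g t ^ n =
    chartHom 𝒜 g hu (Away.mk 𝒜 hd n a ha) := by
    generalize chartHom 𝒜 g hu (Away.mk 𝒜 hd n a ha) = z
    rw [ht, one_pow, mul_one]
  exact h1.symm.trans h

theorem comp_chartHom (φ : R →+* S) (g : A →+* R) {t : A} (ht : IsUnit (g t)) :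
    φ.comp (chartHom 𝒜 g ht) = chartHom 𝒜 (φ.comp g) (ht.map φ) := by
  rw [chartHom, chartHom, ← RingHom.comp_assoc]
  congr 1
  refine IsLocalization.ringHom_ext (Submonoid.powers t) (RingHom.ext fun a => ?_)
  simp [Localization.awayLift, IsLocalization.Away.lift_eq]

theorem chartHom_comp_awayMap (g : A →+* R) {t s x : A} {e : ℕ} (hs : s ∈ 𝒜 e) (hx : x = t * s)
    (ht : IsUnit (g t)) (hxu : IsUnit (g x)) :
    (chartHom 𝒜 g hxu).comp (awayMap 𝒜 hs hx) = chartHom 𝒜 g ht := by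
  have h : (Localization.awayLift g x hxu).comp
      (Localization.awayLift (algebraMap A (Localization.Away x)) t
        (isUnit_of_dvd_unit (map_dvd _ ⟨s, hx⟩) (IsLocalization.Away.algebraMap_isUnit x))) =
      Localization.awayLift g t ht := by
    refine IsLocalization.ringHom_ext (Submonoid.powers t) (RingHom.ext fun a => ?_)
    simp [Localization.awayLift, IsLocalization.Away.lift_eq]
  refine RingHom.ext fun z => ?_
  refine (congrArg (Localization.awayLift g x hxu) (val_awayMap 𝒜 hs hx z)).trans ?_
  exact RingHom.congr_fun h z.val

/-- Fractions of degree zero do not change when homogeneous coordinates are rescaled. -/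
theorem chartHom_eq_of_smul (g g' : A →+* R) (c : R) (hc : IsUnit c)
    (h : ∀ d, ∀ a ∈ 𝒜 d, g' a = c ^ d * g a) {t : A} {d : ℕ} (hd : t ∈ 𝒜 d) (ht : IsUnit (g t))
    (ht' : IsUnit (g' t)) : chartHom 𝒜 g' ht' = chartHom 𝒜 g ht := by
  refine RingHom.ext fun z => ?_
  obtain ⟨n, a, ha, rfl⟩ := Away.mk_surjective 𝒜 hd z
  have h1 := chartHom_mk_mul 𝒜 g ht hd n a ha
  have h2 := chartHom_mk_mul 𝒜 g' ht' hd n a ha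
  rw [h _ _ ha, h _ _ hd, ← h1, mul_pow, ← pow_mul, smul_eq_mul, mul_comm n d] at h2
  refine (((hc.pow (d * n)).mul (ht.pow n))).mul_right_cancel ?_
  rw [h2]
  ring

theorem chartHom_comp_fromZeroRingHom (g : A →+* R) {t : A} (ht : IsUnit (g t)) :
    (chartHom 𝒜 g ht).comp (fromZeroRingHom 𝒜 (.powers t)) =
      g.comp (algebraMap (𝒜 0) A) := by
  refine RingHom.ext fun z => ?_
  have : (algebraMap (Away 𝒜 t) (Localization.Away t)) (fromZeroRingHom 𝒜 (.powers t) z) =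
    algebraMap A _ (z : A) := rfl
  refine (congrArg (Localization.awayLift g t ht) this).trans ?_
  exact IsLocalization.Away.lift_eq t ht _

/-- The point of `Proj` with homogeneous coordinates given by `g`. -/
noncomputable def projPoint (g : A →+* R) {t : A} (ht : IsUnit (g t)) {d : ℕ} (hd : t ∈ 𝒜 d)
    (h0 : 0 < d) : Spec (.of R) ⟶ Proj 𝒜 :=
  Spec.map (CommRingCat.ofHom (chartHom 𝒜 g ht)) ≫ Proj.awayι 𝒜 t hd h0

theorem projPoint_eq_projPoint_mul (g : A →+* R) {t s x : A} (hx : x = t * s) (ht : IsUnit (g t))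
    (hxu : IsUnit (g x)) {d e f : ℕ} (hd : t ∈ 𝒜 d) (h0 : 0 < d) (he : s ∈ 𝒜 e) (hf : x ∈ 𝒜 f)
    (hdf : f = d + e) (hf0 : 0 < f) :
    projPoint 𝒜 g ht hd h0 = projPoint 𝒜 g hxu hf hf0 := by
  subst hdf
  rw [projPoint, projPoint, ← chartHom_comp_awayMap 𝒜 g he hx ht hxu, CommRingCat.ofHom_comp,
    Spec.map_comp, Category.assoc, Proj.SpecMap_awayMap_awayι]

/-- Both charts are compared with the smaller chart where `t * s` is invertible. -/
theorem projPoint_eq (g : A →+* R) {t s : A} (ht : IsUnit (g t))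
    (hs : IsUnit (g s)) {d e : ℕ} (hd : t ∈ 𝒜 d) (h0 : 0 < d) (he : s ∈ 𝒜 e) (he0 : 0 < e) :
    projPoint 𝒜 g ht hd h0 = projPoint 𝒜 g hs he he0 := by
  have hu : IsUnit (g (t * s)) := by rw [map_mul]; exact ht.mul hs
  rw [projPoint_eq_projPoint_mul 𝒜 g rfl ht hu hd h0 he (SetLike.mul_mem_graded hd he) rfl
      (Nat.add_pos_left h0 e),
    projPoint_eq_projPoint_mul 𝒜 g (mul_comm t s) hs hu he he0 hd (SetLike.mul_mem_graded hd he)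
      (add_comm d e) (Nat.add_pos_left h0 e)]

theorem map_projPoint (φ : R →+* S) (g : A →+* R) {t : A} (ht : IsUnit (g t)) {d : ℕ}
    (hd : t ∈ 𝒜 d) (h0 : 0 < d) :
    Spec.map (CommRingCat.ofHom φ) ≫ projPoint 𝒜 g ht hd h0 =
      projPoint 𝒜 (φ.comp g) (ht.map φ) hd h0 := by
  rw [projPoint, projPoint, ← comp_chartHom, CommRingCat.ofHom_comp, Spec.map_comp,
    Category.assoc]

theorem projPoint_eq_of_smul (g g' : A →+* R) (c : R) (hc : IsUnit c)
    (h : ∀ d, ∀ a ∈ 𝒜 d, g' a = c ^ d * g a) {t : A} {d : ℕ} (hd : t ∈ 𝒜 d) (h0 : 0 < d)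
    (ht : IsUnit (g t)) (ht' : IsUnit (g' t)) :
    projPoint 𝒜 g' ht' hd h0 = projPoint 𝒜 g ht hd h0 := by
  rw [projPoint, projPoint, chartHom_eq_of_smul 𝒜 g g' c hc h hd ht ht']

theorem projPoint_toSpecZero (g : A →+* R) {t : A} (ht : IsUnit (g t)) {d : ℕ} (hd : t ∈ 𝒜 d)
    (h0 : 0 < d) : projPoint 𝒜 g ht hd h0 ≫ Proj.toSpecZero 𝒜 =
      Spec.map (CommRingCat.ofHom (g.comp (algebraMap (𝒜 0) A))) := by
  rw [projPoint, Category.assoc, Proj.awayι_toSpecZero, ← Spec.map_comp, ← CommRingCat.ofHom_comp,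
    chartHom_comp_fromZeroRingHom]

theorem projPoint_preimage_basicOpen (g : A →+* R) {t : A} (ht : g t = 1) (ht1 : t ∈ 𝒜 1)
    {s : A} (hs : s ∈ 𝒜 1) :
    projPoint 𝒜 g (ht ▸ isUnit_one) ht1 one_pos ⁻¹ᵁ Proj.basicOpen 𝒜 s =
      PrimeSpectrum.basicOpen (g s) := by
  have h : g s = chartHom 𝒜 g (ht ▸ isUnit_one) (Away.isLocalizationElem ht1 hs) := by
    refine ((chartHom_mk 𝒜 g ht ht1 1 (s ^ 1) (by simpa using hs)).trans ?_).symm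
    rw [pow_one]
  rw [projPoint, Scheme.Hom.comp_preimage, Proj.awayι_preimage_basicOpen 𝒜 ht1 one_pos hs
    one_pos, h]
  rfl

/-- Since `g t = 1`, a homogeneous `a` of degree `i` has the same value as the degree-zero fraction
`a / t ^ i`. -/
theorem chartHom_surjective (g : A →+* R) (hg : Function.Surjective g) {t : A} (ht : g t = 1)
    (ht1 : t ∈ 𝒜 1) : Function.Surjective (chartHom 𝒜 g (t := t) (ht ▸ isUnit_one)) := by
  intro r
  obtain ⟨a, rfl⟩ := hg r
  induction a using DirectSum.Decomposition.inductionOn 𝒜 with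
  | zero => exact ⟨0, by simp⟩
  | @homogeneous i a =>
    exact ⟨Away.mk 𝒜 ht1 i a (by simp), chartHom_mk 𝒜 g ht ht1 i a (by simp)⟩
  | add a b ha hb =>
    obtain ⟨x, hx⟩ := ha
    obtain ⟨y, hy⟩ := hb
    exact ⟨x + y, by rw [map_add, map_add, hx, hy]⟩

theorem isPreimmersion_projPoint (g : A →+* R) (hg : Function.Surjective g) {t : A} (ht : g t = 1)
    (ht1 : t ∈ 𝒜 1) : IsPreimmersion (projPoint 𝒜 g (ht ▸ isUnit_one) ht1 one_pos) := by
  have := IsClosedImmersion.spec_of_surjective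
    (CommRingCat.ofHom (chartHom 𝒜 g (t := t) (ht ▸ isUnit_one)))
    (chartHom_surjective 𝒜 g hg ht ht1)
  exact inferInstanceAs (IsPreimmersion (_ ≫ _))

end ProjectivePoint

end CurveCover

/-! ### Gluing an embedding into projective space from affine charts -/

namespace CurveCover

attribute [local instance] MvPolynomial.gradedAlgebra

theorem isDominant_of_comp_isOpenImmersion {W P X : Scheme.{u}} (q : W ⟶ P) (i : P ⟶ X)
    [IsOpenImmersion i] [IsDominant (q ≫ i)] : IsDominant q := by
  refine ⟨dense_iff_inter_open.2 fun V hV hne => ?_⟩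
  have hd : DenseRange (q ≫ i) := IsDominant.denseRange
  obtain ⟨_, ⟨y, hyV, hy⟩, ⟨w, rfl⟩⟩ := dense_iff_inter_open.1 hd (i '' V)
    (i.isOpenEmbedding.isOpenMap V hV) (hne.image i)
  refine ⟨q w, ?_, w, rfl⟩
  have : i (q w) = i y := by rw [hy, Scheme.Hom.comp_apply]
  rwa [i.isOpenEmbedding.injective this]

/-- The homomorphism from `K` to the sections of a scheme over `K`. -/
noncomputable def scalarHom {K : Type u} [Field K] {X : Scheme.{u}} (h : X ⟶ Spec (.of K))
    (U : X.Opens) : K →+* Γ(X, U) :=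
  ((Scheme.ΓSpecIso (.of K)).inv ≫ h.appLE ⊤ U (by rw [Scheme.Hom.preimage_top]; exact le_top)).hom

theorem toSpecΓ_map_scalarHom {K : Type u} [Field K] {X : Scheme.{u}} (h : X ⟶ Spec (.of K))
    (U : X.Opens) : U.toSpecΓ ≫ Spec.map (CommRingCat.ofHom (scalarHom h U)) = U.ι ≫ h := by
  have h1 : CommRingCat.ofHom (scalarHom h U) =
    (Scheme.ΓSpecIso (.of K)).inv ≫ h.appLE ⊤ U
      (by rw [Scheme.Hom.preimage_top]; exact le_top) := rfl
  rw [h1, Spec.map_comp, Scheme.Opens.toSpecΓ_SpecMap_appLE_assoc, Scheme.Opens.toSpecΓ_top,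
    Category.assoc, Scheme.Hom.resLE_comp_ι_assoc]
  have h2 : (Spec (CommRingCat.of K)).toSpecΓ ≫ Spec.map (Scheme.ΓSpecIso (.of K)).inv = 𝟙 _ := by
    rw [← SpecMap_ΓSpecIso_hom, ← Spec.map_comp, Iso.inv_hom_id, Spec.map_id]
  rw [h2, Category.comp_id]

/-- A scheme covered by affine open sets whose coordinate rings are generated by quotients of
rational functions is embedded into projective space by these functions. -/
theorem exists_isClosedImmersion_projectiveSpace {K : Type u} [Field K] {X : Scheme.{u}}
    [IsIntegral X] (h : X ⟶ Spec (.of K)) [IsProper h] {N : ℕ} {J : Type*}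
    (j : J → Fin (N + 1)) (U : J → X.Opens) (hU : ∀ a, IsAffineOpen (U a))
    (hne : ∀ a, genericPoint X ∈ U a) (htop : ⨆ a, U a = ⊤)
    (g : ∀ a, MvPolynomial (Fin (N + 1)) K →+* Γ(X, U a))
    (hgC : ∀ a, (g a).comp MvPolynomial.C = scalarHom h (U a))
    (hgX : ∀ a, g a (MvPolynomial.X (j a)) = 1)
    (hgs : ∀ a, Function.Surjective (g a))
    (hgU : ∀ a b, X.basicOpen (g b (MvPolynomial.X (j a))) ≤ U a)
    (s : MvPolynomial (Fin (N + 1)) K →+* X.functionField) (hs : ∀ a, s (MvPolynomial.X (j a)) ≠ 0)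
    (hgerm : ∀ a d, ∀ p ∈ polyGrading K N d,
      s p = s (MvPolynomial.X (j a)) ^ d * X.presheaf.germ (U a) (genericPoint X) (hne a) (g a p)) :
    ∃ i : Over.mk h ⟶ projectiveSpace K N, IsClosedImmersion i.left := by
  let P := Proj (polyGrading K N)
  let f (a : J) : (U a).toScheme ⟶ P := (U a).toSpecΓ ≫
    projPoint (polyGrading K N) (g a) ((hgX a) ▸ isUnit_one) (X_mem_polyGrading (j a)) one_pos
  -- At the generic point every chart map has the coordinates `s` up to a scalar. This point is
  -- dominant in the reduced overlaps, so the chart maps agree there and glue.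
  have hgen (a : J) : (U a).fromSpecStalkOfMem (genericPoint X) (hne a) ≫ f a =
      projPoint (polyGrading K N) s (isUnit_iff_ne_zero.2 (hs a)) (X_mem_polyGrading (j a))
        one_pos := by
    change _ ≫ (U a).toSpecΓ ≫ _ = _
    rw [Scheme.Opens.fromSpecStalkOfMem_toSpecΓ_assoc]
    refine (map_projPoint (polyGrading K N) (X.presheaf.germ (U a) (genericPoint X) (hne a)).hom
      (g a) (hgX a ▸ isUnit_one) (X_mem_polyGrading (j a)) one_pos).trans ?_
    exact (projPoint_eq_of_smul (polyGrading K N) _ s (s (MvPolynomial.X (j a)))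
      (isUnit_iff_ne_zero.2 (hs a)) (hgerm a) (X_mem_polyGrading (j a)) one_pos _ _).symm
  let 𝒰 := X.openCoverOfIsOpenCover U htop
  have hcompat (a b : J) : Limits.pullback.fst (U a).ι (U b).ι ≫ f a =
      Limits.pullback.snd (U a).ι (U b).ι ≫ f b := by
    let q : Spec X.functionField ⟶ Limits.pullback (U a).ι (U b).ι :=
      Limits.pullback.lift ((U a).fromSpecStalkOfMem (genericPoint X) (hne a))
        ((U b).fromSpecStalkOfMem (genericPoint X) (hne b)) (by
          rw [Scheme.Opens.fromSpecStalkOfMem_ι, Scheme.Opens.fromSpecStalkOfMem_ι])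
    have hq : q ≫ Limits.pullback.fst (U a).ι (U b).ι ≫ (U a).ι = genericInclusion X := by
      rw [Limits.pullback.lift_fst_assoc, Scheme.Opens.fromSpecStalkOfMem_ι]
    have : IsDominant (q ≫ Limits.pullback.fst (U a).ι (U b).ι ≫ (U a).ι) := by
      rw [hq]
      infer_instance
    have := isDominant_of_comp_isOpenImmersion q (Limits.pullback.fst (U a).ι (U b).ι ≫ (U a).ι)
    have : AlgebraicGeometry.IsReduced (Limits.pullback (U a).ι (U b).ι) :=
      isReduced_of_isOpenImmersion (Limits.pullback.fst (U a).ι (U b).ι)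
    refine ext_of_isDominant q ?_
    rw [Limits.pullback.lift_fst_assoc, Limits.pullback.lift_snd_assoc, hgen, hgen]
    exact projPoint_eq _ _ _ _ _ _ _ _
  let F : X ⟶ P := 𝒰.glueMorphisms f hcompat
  have hF (a : J) : (U a).ι ≫ F = f a := 𝒰.ι_glueMorphisms f hcompat a
  let G : P ⟶ Spec (.of K) := Proj.toSpecZero (polyGrading K N) ≫
    Spec.map (CommRingCat.ofHom (algebraMap K (polyGrading K N 0)))
  have hFh : F ≫ G = h := by
    refine 𝒰.hom_ext _ _ fun (a : J) => ?_
    change (U a).ι ≫ F ≫ G = (U a).ι ≫ h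
    rw [← Category.assoc, hF, ← toSpecΓ_map_scalarHom, ← hgC a]
    change ((U a).toSpecΓ ≫ _) ≫ _ = _
    rw [Category.assoc]
    congr 1
    refine (Category.assoc _ _ _).symm.trans ?_
    refine (congrArg (· ≫ _) (projPoint_toSpecZero (polyGrading K N) (g a) _ _ _)).trans ?_
    exact (Spec.map_comp _ _).symm
  have hpre (a b : J) : f b ⁻¹ᵁ Proj.basicOpen (polyGrading K N) (MvPolynomial.X (j a)) =
      (U b).ι ⁻¹ᵁ X.basicOpen (g b (MvPolynomial.X (j a))) := by
    rw [← Scheme.Opens.toSpecΓ_preimage_basicOpen,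
      ← projPoint_preimage_basicOpen (polyGrading K N) (g b) (hgX b) (X_mem_polyGrading (j b))
        (X_mem_polyGrading (j a))]
    rfl
  have himm (a : J) : IsPreimmersion (f a) := by
    have := isPreimmersion_projPoint (polyGrading K N) (g a) (hgs a) (hgX a)
      (X_mem_polyGrading (j a))
    have : IsIso (U a).toSpecΓ := (hU a).isoSpec.isIso_hom
    exact inferInstanceAs (IsPreimmersion (_ ≫ _))
  have hcov (x : X) : ∃ a, x ∈ U a := TopologicalSpace.Opens.mem_iSup.1 (htop ▸ trivial)
  -- Together with `hFmem'`, this makes `U a` exactly the preimage of a standard chart, so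
  -- injectivity may be checked on each `U a`.
  have hFmem (a : J) (x : X) (hx : F x ∈ Proj.basicOpen (polyGrading K N) (MvPolynomial.X (j a))) :
      x ∈ U a := by
    obtain ⟨b, hb⟩ := hcov x
    have : (⟨x, hb⟩ : U b) ∈ f b ⁻¹ᵁ Proj.basicOpen (polyGrading K N) (MvPolynomial.X (j a)) := by
      rw [← hF b]
      exact hx
    rw [hpre] at this
    exact hgU a b this
  have hFmem' (a : J) (x : X) (hx : x ∈ U a) :
      F x ∈ Proj.basicOpen (polyGrading K N) (MvPolynomial.X (j a)) := by
    have : (⟨x, hx⟩ : U a) ∈ f a ⁻¹ᵁ Proj.basicOpen (polyGrading K N) (MvPolynomial.X (j a)) := by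
      rw [hpre, hgX, Scheme.basicOpen_of_isUnit _ isUnit_one]
      exact hx
    rw [← hF a] at this
    exact this
  have hinj : Function.Injective F := by
    intro x y hxy
    obtain ⟨a, ha⟩ := hcov x
    have hb : y ∈ U a := hFmem a y (hxy ▸ hFmem' a x ha)
    have : f a ⟨x, ha⟩ = f a ⟨y, hb⟩ := by
      rw [← hF a]
      exact hxy
    exact congrArg Subtype.val ((f a).isEmbedding.injective this)
  have : SurjectiveOnStalks F := by
    refine IsZariskiLocalAtSource.of_openCover (P := @SurjectiveOnStalks) 𝒰 fun (a : J) => ?_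
    change SurjectiveOnStalks ((U a).ι ≫ F)
    rw [hF]
    infer_instance
  have : IsProper F := by
    have : IsProper (F ≫ G) := by
      rw [hFh]
      infer_instance
    have : IsProper G := inferInstanceAs (IsProper (projectiveSpace K N).hom)
    exact IsProper.of_comp F G
  refine ⟨Over.homMk F hFh, ?_⟩
  change IsClosedImmersion F
  exact ⟨.of_continuous_injective_isClosedMap F.continuous hinj F.isClosedMap⟩

end CurveCover

/-! ### Proper schemes with an ample family are projective -/

namespace CurveCover

attribute [local instance] MvPolynomial.gradedAlgebra

theorem eval₂_mul_of_isHomogeneous {σ R S : Type*} [CommSemiring R] [CommSemiring S]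
    (c : R →+* S) (l : S) (y : σ → S) {p : MvPolynomial σ R} {d : ℕ} (hp : p.IsHomogeneous d) :
    p.eval₂ c (fun i => l * y i) = l ^ d * p.eval₂ c y := by
  rw [MvPolynomial.eval₂_eq, MvPolynomial.eval₂_eq, Finset.mul_sum]
  refine Finset.sum_congr rfl fun k hk => ?_
  rw [hp.degree_eq_sum_deg_support hk]
  simp only [mul_pow, Finset.prod_mul_distrib, Finset.prod_pow_eq_pow_sum]
  ring

section

variable {X : Scheme.{u}} [IsIntegral X]

theorem genericPoint_mem (U : X.Opens) [hU : Nonempty U] : genericPoint X ∈ U :=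
  ((genericPoint_spec X).mem_open_set_iff U.isOpen).2
    (by obtain ⟨x⟩ := hU; exact ⟨x.1, trivial, x.2⟩)

/-- A rational function that is regular on an affine open set `V` intersecting another affine open
set in the nonvanishing locus of `v` becomes regular there after multiplication with a power
of `v`. -/
theorem exists_germ_eq_mul_pow {U V : X.Opens} (hU : IsAffineOpen U) [Nonempty U] [Nonempty V]
    (v : Γ(X, U)) (hv : X.basicOpen v ≤ V) [Nonempty (X.basicOpen v)] (t : Γ(X, V)) :
    ∃ m : ℕ, ∀ k ≥ m, ∃ w : Γ(X, U), X.germToFunctionField U w =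
      X.germToFunctionField V t * X.germToFunctionField U v ^ k := by
  have hloc := hU.isLocalization_basicOpen v
  have hres {W : X.Opens} [Nonempty W] (hW : X.basicOpen v ≤ W) (z : Γ(X, W)) :
      X.germToFunctionField (X.basicOpen v) (X.presheaf.map (homOfLE hW).op z) =
        X.germToFunctionField W z :=
    X.presheaf.germ_res_apply (homOfLE hW) _ _ z
  obtain ⟨⟨w, ⟨_, m, rfl⟩⟩, hw⟩ := IsLocalization.surj (Submonoid.powers v)
    (X.presheaf.map (homOfLE hv).op t)
  have hw' := congrArg (X.germToFunctionField (X.basicOpen v)) hw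
  rw [map_mul] at hw'
  have h1 := hres (X.basicOpen_le v) w
  have h2 := hres (X.basicOpen_le v) (v ^ m)
  have h3 := hres hv t
  refine ⟨m, fun k hk => ⟨w * v ^ (k - m), ?_⟩⟩
  rw [map_mul, map_pow]
  have h4 : X.germToFunctionField U w =
      X.germToFunctionField V t * X.germToFunctionField U v ^ m := by
    refine h1.symm.trans (hw'.symm.trans (congrArg₂ (· * ·) h3 (h2.trans (map_pow _ _ _))))
  rw [h4, mul_assoc, ← pow_add, Nat.add_sub_cancel' hk]

theorem germToFunctionField_scalarHom {K : Type u} [Field K] (h : X ⟶ Spec (.of K))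
    (U : X.Opens) [Nonempty U] (c : K) :
    X.germToFunctionField U (scalarHom h U c) =
      X.presheaf.germ ⊤ (genericPoint X) trivial (scalarHom h ⊤ c) := by
  have h1 : h.appLE ⊤ ⊤ (by rw [Scheme.Hom.preimage_top]) ≫
      X.presheaf.map (homOfLE le_top).op = 
        h.appLE ⊤ U (by rw [Scheme.Hom.preimage_top]; exact le_top) :=
    Scheme.Hom.appLE_map _ _ _
  have h2 := X.presheaf.germ_res_apply (homOfLE (le_top : U ≤ ⊤)) (genericPoint X)
    (genericPoint_mem U) (scalarHom h ⊤ c)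
  refine Eq.trans ?_ h2
  refine congrArg (X.germToFunctionField U) ?_
  exact (ConcreteCategory.congr_hom h1 ((Scheme.ΓSpecIso (.of K)).inv c)).symm

end

theorem scalarHom_finiteType {K : Type u} [Field K] {X : Scheme.{u}}
    (h : X ⟶ Spec (.of K)) [LocallyOfFiniteType h]
    {U : X.Opens} (hU : IsAffineOpen U) : (scalarHom h U).FiniteType := by
  have h1 := h.finiteType_appLE (isAffineOpen_top _) hU
    (by rw [Scheme.Hom.preimage_top]; exact le_top)
  refine h1.comp (RingHom.FiniteType.of_surjective _ ?_)
  exact (ConcreteCategory.bijective_of_isIso (Scheme.ΓSpecIso (.of K)).inv).2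

/-- A proper scheme with an ample family is projective. -/
theorem AmpleFamily.exists_isClosedImmersion {K : Type u} [Field K] {X : Scheme.{u}}
    [IsIntegral X] (a : AmpleFamily X) (h : X ⟶ Spec (.of K)) [IsProper h] :
    ∃ (n : ℕ) (i : Over.mk h ⟶ projectiveSpace K n), IsClosedImmersion i.left := by
  classical
  have := a.finite
  have hne := a.nonempty
  let alg (k : a.ι) : Algebra K Γ(X, a.U k) := (scalarHom h (a.U k)).toAlgebra
  have hft (k : a.ι) : ∃ T : Finset Γ(X, a.U k), Algebra.adjoin K (T : Set Γ(X, a.U k)) = ⊤ :=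
    (scalarHom_finiteType h (a.isAffineOpen k)).out
  choose T hT using hft
  have hgp (k) : genericPoint X ∈ a.U k := genericPoint_mem (a.U k)
  have hu1 (k) : a.u k k = 1 := by
    apply X.germToFunctionField_injective (a.U k)
    rw [a.germ_u, div_self (a.ξ_ne_zero k), map_one]
  -- There are finitely many charts and generators, so one exponent clears all their poles;
  -- requiring `m ≥ 1` as well keeps the nonvanishing locus of `u k i ^ m` equal to that of `u k i`.
  have hev : ∀ᶠ m in Filter.atTop, ∀ i k, ∀ t ∈ T i, ∃ w : Γ(X, a.U k),
      X.germToFunctionField (a.U k) w =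
        X.germToFunctionField (a.U i) t * (a.ξ i / a.ξ k) ^ m := by
    rw [Filter.eventually_all]
    intro i
    rw [Filter.eventually_all]
    intro k
    rw [Filter.eventually_all_finset]
    intro t _
    have hb : X.basicOpen (a.u k i) = a.U k ⊓ a.U i := a.basicOpen_u k i
    have : Nonempty (X.basicOpen (a.u k i)) := ⟨⟨genericPoint X, hb ▸ ⟨hgp k, hgp i⟩⟩⟩
    obtain ⟨m, hm⟩ := exists_germ_eq_mul_pow (a.isAffineOpen k) (a.u k i)
      (hb.le.trans inf_le_right) t
    rw [a.germ_u] at hm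
    exact Filter.eventually_atTop.2 ⟨m, hm⟩
  obtain ⟨m, hm, hm1⟩ := (hev.and (Filter.eventually_ge_atTop 1)).exists
  choose w hw using hm
  -- The homogeneous coordinates are `ξ i ^ m` and `t * ξ i ^ m` for the algebra generators `t` of
  -- the `i`-th chart. Dividing by `ξ k ^ m` makes them regular on chart `k`, where they include its
  -- generators.
  let σ := Σ i, Option (T i)
  have : Finite σ := inferInstance
  obtain ⟨N, ⟨e⟩⟩ : ∃ N, Nonempty (Fin (N + 1) ≃ σ) := by
    have hmem : genericPoint X ∈ ⨆ i, a.U i := a.iSup_eq_top ▸ trivial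
    obtain ⟨i, _⟩ := TopologicalSpace.Opens.mem_iSup.1 hmem
    have : Nonempty σ := ⟨⟨i, none⟩⟩
    obtain ⟨N, hN⟩ := Nat.exists_eq_succ_of_ne_zero (Nat.card_pos (α := σ)).ne'
    exact ⟨N, ⟨(finCongr hN).symm.trans (Finite.equivFin σ).symm⟩⟩
  let s (α : σ) : X.functionField :=
    match α with
    | ⟨i, none⟩ => a.ξ i ^ m
    | ⟨i, some t⟩ => X.germToFunctionField (a.U i) t.1 * a.ξ i ^ m
  let v (k : a.ι) (α : σ) : Γ(X, a.U k) :=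
    match α with
    | ⟨i, none⟩ => a.u k i ^ m
    | ⟨i, some t⟩ => w i k t.1 t.2
  have hv (k : a.ι) (α : σ) : s α = a.ξ k ^ m * X.germToFunctionField (a.U k) (v k α) := by
    have hk : a.ξ k ≠ 0 := a.ξ_ne_zero k
    obtain ⟨i, _ | t⟩ := α
    · change a.ξ i ^ m = a.ξ k ^ m * X.germToFunctionField (a.U k) (a.u k i ^ m)
      rw [map_pow, a.germ_u, div_pow]
      field_simp
    · change X.germToFunctionField (a.U i) t.1 * a.ξ i ^ m =
        a.ξ k ^ m * X.germToFunctionField (a.U k) (w i k t.1 t.2)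
      rw [hw, div_pow]
      field_simp
  let c : K →+* X.functionField :=
    (X.presheaf.germ ⊤ (genericPoint X) trivial).hom.comp (scalarHom h ⊤)
  let g (k : a.ι) : MvPolynomial (Fin (N + 1)) K →+* Γ(X, a.U k) :=
    MvPolynomial.eval₂Hom (scalarHom h (a.U k)) (fun n => v k (e n))
  have hgX (k : a.ι) (α : σ) : g k (MvPolynomial.X (e.symm α)) = v k α := by
    simp [g]
  have hgerm (k : a.ι) : (X.germToFunctionField (a.U k)).hom.comp (g k) =
      MvPolynomial.eval₂Hom c (fun n => X.germToFunctionField (a.U k) (v k (e n))) := by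
    refine MvPolynomial.ringHom_ext (fun x => ?_) fun n => ?_
    · simp only [g, RingHom.comp_apply, MvPolynomial.coe_eval₂Hom, MvPolynomial.eval₂_C]
      exact germToFunctionField_scalarHom h (a.U k) x
    · simp [g]
  refine ⟨N, exists_isClosedImmersion_projectiveSpace h (fun k => e.symm ⟨k, none⟩) a.U
    a.isAffineOpen hgp a.iSup_eq_top g (fun k => ?_) (fun k => ?_) (fun k => ?_) (fun i k => ?_)
    (MvPolynomial.eval₂Hom c (fun n => s (e n))) (fun k => ?_) (fun k d p hp => ?_)⟩
  · exact MvPolynomial.eval₂Hom_comp_C _ _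
  · rw [hgX]
    change a.u k k ^ m = 1
    rw [hu1, one_pow]
  · have hr : (MvPolynomial.aeval (R := K) (fun n => v k (e n))).range = ⊤ := by
      rw [← Algebra.adjoin_range_eq_range_aeval, ← hT k, eq_comm]
      refine le_antisymm (Algebra.adjoin_mono ?_) (hT k ▸ le_top)
      intro t ht
      refine ⟨e.symm ⟨k, some ⟨t, ht⟩⟩, ?_⟩
      apply X.germToFunctionField_injective (a.U k)
      change X.germToFunctionField (a.U k) (v k (e (e.symm _))) = _
      rw [e.apply_symm_apply]
      change X.germToFunctionField (a.U k) (w k k t ht) = _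
      rw [hw, div_self (a.ξ_ne_zero k), one_pow, mul_one]
    exact AlgHom.range_eq_top _ |>.1 hr
  · rw [hgX]
    change X.basicOpen (a.u k i ^ m) ≤ _
    rw [Scheme.basicOpen_pow _ _ hm1, a.basicOpen_u]
    exact inf_le_right
  · simp only [MvPolynomial.coe_eval₂Hom, MvPolynomial.eval₂_X, e.apply_symm_apply]
    exact pow_ne_zero _ (a.ξ_ne_zero k)
  · have h1 := RingHom.congr_fun (hgerm k) p
    refine Eq.trans ?_ (congrArg₂ (· * ·) rfl h1.symm)
    simp only [MvPolynomial.coe_eval₂Hom, MvPolynomial.eval₂_X, e.apply_symm_apply, hv k]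
    rw [eval₂_mul_of_isHomogeneous _ _ _ hp]
    have : X.germToFunctionField (a.U k) (v k ⟨k, none⟩) = 1 := by
      change X.germToFunctionField (a.U k) (a.u k k ^ m) = 1
      rw [hu1, one_pow, map_one]
    rw [this, mul_one]

end CurveCover

/-! ### The normalization of a curve is a curve -/

namespace CurveCover

attribute [local instance] MvPolynomial.gradedAlgebra

theorem geometricallyIrreducible_of_surjective {X Y S : Scheme.{u}} (s : X ⟶ Y) (g : Y ⟶ S)
    [Surjective s] (h : GeometricallyIrreducible (s ≫ g)) : GeometricallyIrreducible g := by
  refine ⟨fun K _ y Z fst snd hZ => ?_⟩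
  have hW := (IsPullback.of_hasPullback s fst).paste_vert hZ
  have : IrreducibleSpace ↥(Limits.pullback s fst) :=
    h.geometrically_irreducibleSpace _ _ _ hW
  exact (Limits.pullback.snd s fst).surjective.irreducibleSpace
    (Limits.pullback.snd s fst).continuous

theorem surjective_of_map_genericPoint {X Y : Scheme.{u}} [IsIntegral X] [IsIntegral Y]
    (f : X ⟶ Y) [UniversallyClosed f] (hf : f (genericPoint X) = genericPoint Y) :
    Surjective f := by
  refine ⟨fun y => ?_⟩
  have hc : IsClosed (Set.range f) := f.isClosedMap.isClosed_range
  exact (genericPoint_specializes y).mem_closed hc ⟨_, hf⟩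

section

variable {K : Type u} [Field K] {C D : Over (Spec (.of K))} [IsCurve C] [IsCurve D]

/-- The normalization of a curve in a finite separable extension of its function field. -/
noncomputable abbrev normalizationCurve (D : Over (Spec (.of K))) [IsCurve D] (L : Type u) [Field L]
    [Algebra D.left.functionField L] [FiniteDimensional D.left.functionField L]
    [Algebra.IsSeparable D.left.functionField L] : Over (Spec (.of K)) :=
  Over.mk ((extensionPoint D.left L).fromNormalization ≫ D.hom)

variable {L : Type u} [Field L] [Algebra D.left.functionField L]
  [FiniteDimensional D.left.functionField L] [Algebra.IsSeparable D.left.functionField L]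

theorem exists_ampleFamily_of_isCurve (D : Over (Spec (.of K))) [IsCurve D] :
    Nonempty (AmpleFamily D.left) := by
  obtain ⟨n, i, hi⟩ := IsCurve.projective (C := D)
  let j : D.left ⟶ Proj (polyGrading K n) := i.left
  have : IsClosedImmersion j := hi
  exact exists_ampleFamily j

/-- The morphism from `C` serves geometric irreducibility, which may fail for a general `L` because
the constant field can grow: properness makes the morphism surjective, and irreducibility passes to
images after base change. -/
theorem isCurve_normalizationCurve (s : C ⟶ normalizationCurve D L)
    (hs : s.left (genericPoint C.left) = genericPoint (extensionPoint D.left L).normalization) :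
    IsCurve (normalizationCurve D L) := by
  let B := (extensionPoint D.left L).normalization
  let π : B ⟶ D.left := (extensionPoint D.left L).fromNormalization
  have hD := isDedekindDomain_of_isCurve D
  have : IsFinite π := isFinite_fromNormalization hD
  have hπ : π (genericPoint B) = genericPoint D.left := fromNormalization_genericPoint _
  have := isProper_hom D
  have : IsProper (π ≫ D.hom) := inferInstance
  have hded := exists_isDedekindDomain_normalization (L := L) hD
  refine ⟨inferInstanceAs (IsIntegral B), fun x => ?_, ?_, ?_, ?_⟩
  · obtain ⟨U, hx, hU, hUD⟩ := hded x
    exact isRegularLocalRing_stalk_of_isDedekindDomain hU hx hUD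
  · obtain ⟨a⟩ := exists_ampleFamily_of_isCurve D
    exact (a.comap π hπ).exists_isClosedImmersion (π ≫ D.hom)
  · have : IsProper (s.left ≫ π ≫ D.hom) := by
      have h : s.left ≫ π ≫ D.hom = C.hom := Over.w s
      rw [h]
      exact isProper_hom C
    have : IsProper s.left := IsProper.of_comp s.left (π ≫ D.hom)
    have : IsIntegral (normalizationCurve D L).left := inferInstanceAs (IsIntegral B)
    have : Surjective s.left := surjective_of_map_genericPoint s.left hs
    refine geometricallyIrreducible_of_surjective s.left (π ≫ D.hom) ?_
    have h : s.left ≫ π ≫ D.hom = C.hom := Over.w s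
    rw [h]
    exact IsCurve.geometricallyIrreducible
  · have : Surjective π := surjective_of_map_genericPoint π hπ
    obtain ⟨y, hy⟩ := exists_ne_genericPoint (C := D)
    obtain ⟨x, rfl⟩ := π.surjective y
    refine topologicalKrullDim_eq_one (X := B) (fun x => ?_) (x := x) fun h => hy (h ▸ hπ)
    obtain ⟨U, hx, hU, hUD⟩ := hded x
    exact ⟨U, hx, hU, inferInstance⟩

end

end CurveCover

/-! ### Intermediate fields and factorizations of covers -/

namespace CurveCover

theorem Nonconstant.of_comp {K : Type u} [Field K] {B C D : Over (Spec (.of K))}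
    (φ₁ : C ⟶ B) (φ₂ : B ⟶ D)
    [h : Nonconstant (φ₁ ≫ φ₂)] : Nonconstant φ₁ ∧ Nonconstant φ₂ :=
  ⟨⟨fun ⟨y, hy⟩ => h.not_constant ⟨φ₂.left y, fun x => congrArg φ₂.left (hy x)⟩⟩,
    ⟨fun ⟨y, hy⟩ => h.not_constant ⟨y, fun x => hy (φ₁.left x)⟩⟩⟩

variable {K : Type u} [Field K] {C D : Over (Spec (.of K))} [IsCurve C] [IsCurve D]

/-- The normalization of `D` in an extension `L` of its function field, over `D`. -/
noncomputable abbrev normalizationCurveHom (D : Over (Spec (.of K))) [IsCurve D] (L : Type u)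
    [Field L] [Algebra D.left.functionField L] [FiniteDimensional D.left.functionField L]
    [Algebra.IsSeparable D.left.functionField L] : normalizationCurve D L ⟶ D :=
  Over.homMk (extensionPoint D.left L).fromNormalization rfl

/-- This is the lifting principle applied to `Spec K(C) ⟶ Spec L ⟶ B`. The last conclusion later
identifies the map of function fields induced by `s` with `l`. -/
theorem exists_lift_normalizationCurve (φ : C ⟶ D) [Nonconstant φ] {L : Type u} [Field L]
    [Algebra D.left.functionField L] [FiniteDimensional D.left.functionField L]
    [Algebra.IsSeparable D.left.functionField L] (l : CommRingCat.of L ⟶ C.left.functionField)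
    (hl : CommRingCat.ofHom (algebraMap D.left.functionField L) ≫ l =
      functionFieldMap φ.left (map_genericPoint φ)) :
    ∃ s : C ⟶ normalizationCurve D L, s ≫ normalizationCurveHom D L = φ ∧
      s.left (genericPoint C.left) = genericPoint (extensionPoint D.left L).normalization ∧
      Spec.map (normalizationFunctionField _ ≫ l) ≫
        genericInclusion (extensionPoint D.left L).normalization =
          genericInclusion C.left ≫ s.left := by
  let i : D.left.functionField ⟶ .of L := CommRingCat.ofHom (algebraMap D.left.functionField L)
  let B := (extensionPoint D.left L).normalization
  let π : B ⟶ D.left := (extensionPoint D.left L).fromNormalization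
  let ν : B.functionField ⟶ .of L := normalizationFunctionField i
  have : IsFinite π := isFinite_fromNormalization (isDedekindDomain_of_isCurve D)
  obtain ⟨s, hsπ, hs⟩ := exists_lift_of_isIntegralHom φ π
    (Spec.map l ≫ (extensionPoint D.left L).toNormalization) (by
      rw [Category.assoc, Scheme.Hom.toNormalization_fromNormalization,
        ← map_functionFieldMap_genericInclusion _ (map_genericPoint φ), ← hl, Spec.map_comp,
        Category.assoc]
      rfl)
  have hνl : Spec.map (ν ≫ l) ≫ genericInclusion B = genericInclusion C.left ≫ s := by
    rw [hs, Spec.map_comp, Category.assoc]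
    congr 1
    exact map_normalizationFunctionField i
  have hsg : s (genericPoint C.left) = genericPoint B := by
    refine genericPoint_of_fieldPoint_comp (L := C.left.functionField)
      (j := 𝟙 _) (k := ν ≫ l) s ?_
    refine Eq.trans ?_ hνl.symm
    rw [fieldPoint, Spec.map_id]
    exact congrArg (· ≫ s) (Category.id_comp _)
  refine ⟨Over.homMk s ?_, Over.OverMorphism.ext hsπ, hsg, hνl⟩
  change s ≫ π ≫ D.hom = C.hom
  rw [← Category.assoc, hsπ]
  exact Over.w φ

theorem isCover_and_degree_eq {B : Over (Spec (.of K))} [IsCurve B] (ψ : C ⟶ B) [Nonconstant ψ]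
    {L M : Type u} [Field L] [Field M] [Algebra L M] [Algebra.IsSeparable L M]
    (e : B.left.functionField ≃+* L) (e' : C.left.functionField ≃+* M)
    (h : (algebraMap L M).comp (e : B.left.functionField →+* L) =
      (e' : C.left.functionField →+* M).comp (functionFieldHom ψ)) :
    IsCover ψ ∧ degree ψ = Module.finrank L M := by
  let e₁ : ExtensionField ψ ≃+* M := e'
  exact ⟨⟨(Algebra.IsSeparable.iff_of_equiv_equiv (B₁ := ExtensionField ψ) e e₁ h).2 inferInstance⟩,
    Algebra.finrank_eq_of_equiv_equiv (S₀ := ExtensionField ψ) e e₁ h⟩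

theorem isCover_and_degree_eq_of_intermediateField {B : Over (Spec (.of K))} [IsCurve B]
    (ψ : C ⟶ B) [Nonconstant ψ] {F E : Type u} [Field F] [Field E] [Algebra F E]
    [Algebra.IsSeparable F E] (L : IntermediateField F E)
    (e : B.left.functionField ≃+* L) (e' : C.left.functionField ≃+* E)
    (h : L.val.toRingHom.comp (e : B.left.functionField →+* L) =
      (e' : C.left.functionField →+* E).comp (functionFieldHom ψ)) :
    IsCover ψ ∧ degree ψ = Module.finrank L E :=
  isCover_and_degree_eq ψ e e' h

/-- The function field of the normalization of `D` in `L` is `L`. -/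
noncomputable def normalizationFunctionFieldEquiv (D : Over (Spec (.of K))) [IsCurve D]
    (L : Type u) [Field L] [Algebra D.left.functionField L]
    [FiniteDimensional D.left.functionField L] [Algebra.IsSeparable D.left.functionField L] :
    (extensionPoint D.left L).normalization.functionField ≃+* L :=
  RingEquiv.ofBijective (normalizationFunctionField _).hom
    ⟨(normalizationFunctionField _).hom.injective, normalizationFunctionField_surjective _
      (algebraMap_isIntegral_iff.2 inferInstance)⟩

/-- A cover factors through the normalization of its target in any intermediate field. -/
theorem exists_factorization (φ : C ⟶ D) [IsCover φ]
    [FiniteDimensional D.left.functionField (ExtensionField φ)]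
    (L : IntermediateField D.left.functionField (ExtensionField φ)) :
    ∃ (B : Over (Spec (.of K))) (_ : IsCurve B) (φ₁ : C ⟶ B) (φ₂ : B ⟶ D)
      (_ : IsCover φ₁) (_ : IsCover φ₂), φ₁ ≫ φ₂ = φ ∧
        degree φ₁ = Module.finrank L (ExtensionField φ) ∧
        degree φ₂ = Module.finrank D.left.functionField L := by
  have hsep : Algebra.IsSeparable D.left.functionField (ExtensionField φ) := IsCover.separable
  have hsep₁ : Algebra.IsSeparable D.left.functionField L := inferInstance
  have hsep₂ : Algebra.IsSeparable L (ExtensionField φ) := inferInstance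
  let l : CommRingCat.of L ⟶ C.left.functionField := CommRingCat.ofHom L.val.toRingHom
  have hl : CommRingCat.ofHom (algebraMap D.left.functionField L) ≫ l =
    functionFieldMap φ.left (map_genericPoint φ) := rfl
  obtain ⟨φ₁, hcomp, hg, hmap⟩ := exists_lift_normalizationCurve φ l hl
  have hB : IsCurve (normalizationCurve D L) := isCurve_normalizationCurve φ₁ hg
  have : Nonconstant (φ₁ ≫ normalizationCurveHom D L) := by
    rw [hcomp]
    infer_instance
  obtain ⟨hn₁, hn₂⟩ := Nonconstant.of_comp φ₁ (normalizationCurveHom D L)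
  have hf₁ := congrArg CommRingCat.Hom.hom (functionFieldMap_eq_of_map_genericInclusion hg hmap)
  have hf₂ := congrArg CommRingCat.Hom.hom (functionFieldMap_fromNormalization
    (CommRingCat.ofHom (algebraMap D.left.functionField L)))
  obtain ⟨hc₁, hd₁⟩ := isCover_and_degree_eq_of_intermediateField φ₁ L
    (normalizationFunctionFieldEquiv D L) (RingEquiv.refl C.left.functionField) hf₁.symm
  obtain ⟨hc₂, hd₂⟩ := isCover_and_degree_eq (normalizationCurveHom D L)
    (L := D.left.functionField) (M := L)
    (RingEquiv.refl _) (normalizationFunctionFieldEquiv D L) hf₂.symm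
  exact ⟨normalizationCurve D L, hB, φ₁, normalizationCurveHom D L, hc₁, hc₂, hcomp, hd₁, hd₂⟩

theorem IsIndecomposable.eq_bot_or_eq_top {φ : C ⟶ D} [IsCover φ] (hφ : IsIndecomposable φ)
    (L : IntermediateField D.left.functionField (ExtensionField φ)) : L = ⊥ ∨ L = ⊤ := by
  -- An infinite extension has `finrank` zero, so degree at least two forces finiteness.
  have : FiniteDimensional D.left.functionField (ExtensionField φ) :=
    Module.finite_of_finrank_pos (zero_lt_two.trans_le hφ.1)
  by_contra! h
  obtain ⟨B, hB, φ₁, φ₂, hc₁, hc₂, hcomp, hd₁, hd₂⟩ := exists_factorization φ L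
  have h₁ : Module.finrank L (ExtensionField φ) ≠ 1 := fun h1 =>
    h.2 (IntermediateField.finrank_eq_one_iff_eq_top.1 h1)
  have h₂ : Module.finrank D.left.functionField L ≠ 1 := fun h1 =>
    h.1 (IntermediateField.finrank_eq_one_iff.1 h1)
  have p₁ : 0 < Module.finrank L (ExtensionField φ) := Module.finrank_pos
  have p₂ : 0 < Module.finrank D.left.functionField L := Module.finrank_pos
  exact hφ.2 ⟨B, hB, φ₁, φ₂, hc₁, hc₂, hcomp, by omega, by omega⟩

end CurveCover

/-! ### Automorphisms of a cover as field automorphisms -/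

namespace CurveCover

theorem nonconstant_of_mem_autGroup {K : Type u} [Field K] {C D : Over (Spec (.of K))} (φ : C ⟶ D)
    [h : Nonconstant φ] (σ : autGroup φ) :
    Nonconstant σ.1.hom :=
  have : Nonconstant (σ.1.hom ≫ φ) := by
    rw [show σ.1.hom ≫ φ = φ from σ.2]
    exact h
  (Nonconstant.of_comp σ.1.hom φ).1

variable {K : Type u} [Field K] {C D : Over (Spec (.of K))} [IsCurve C] [IsCurve D]

/-- The generic point is dense in the reduced scheme `C`, and `D` is separated. -/
theorem hom_ext_of_genericInclusion {s t : C ⟶ D}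
    (h : genericInclusion C.left ≫ s.left = genericInclusion C.left ≫ t.left) : s = t := by
  have := isProper_hom D
  exact Over.OverMorphism.ext (ext_of_isDominant_of_isSeparated D.hom
    ((Over.w s).trans (Over.w t).symm) (genericInclusion C.left) h)

theorem exists_hom_of_algHom (φ : C ⟶ D) [Nonconstant φ]
    (θ : ExtensionField φ →ₐ[D.left.functionField] ExtensionField φ) :
    ∃ s : C ⟶ C, s ≫ φ = φ ∧ genericInclusion C.left ≫ s.left =
      Spec.map (show C.left.functionField ⟶ C.left.functionField from
        CommRingCat.ofHom θ.toRingHom) ≫ genericInclusion C.left := by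
  let t : C.left.functionField ⟶ C.left.functionField := CommRingCat.ofHom θ.toRingHom
  have ht : functionFieldMap φ.left (map_genericPoint φ) ≫ t =
      functionFieldMap φ.left (map_genericPoint φ) := by
    refine CommRingCat.hom_ext (RingHom.ext fun x => ?_)
    exact θ.commutes x
  have := isFinite_left φ
  -- The lifting principle is used with `φ` as its own integral target.
  obtain ⟨s, hs, hst⟩ := exists_lift_of_isIntegralHom φ φ.left
    (Spec.map t ≫ genericInclusion C.left) (by
      rw [Category.assoc, ← map_functionFieldMap_genericInclusion _ (map_genericPoint φ),
        ← Category.assoc, ← Spec.map_comp, ht])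
  refine ⟨Over.homMk s ?_, Over.OverMorphism.ext hs, hst⟩
  rw [← Over.w φ, ← Category.assoc, hs]

/-- The homomorphism of function fields induced by an automorphism of a cover. -/
noncomputable def autGroupAlgHom (φ : C ⟶ D) [Nonconstant φ] (σ : autGroup φ) :
    ExtensionField φ →ₐ[D.left.functionField] ExtensionField φ :=
  have := nonconstant_of_mem_autGroup φ σ
  { functionFieldHom σ.1.hom with
    commutes' := fun x => by
      have h : functionFieldMap φ.left (map_genericPoint φ) ≫
          functionFieldMap σ.1.hom.left (map_genericPoint σ.1.hom) =
            functionFieldMap φ.left (map_genericPoint φ) := by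
        refine (functionFieldMap_eq_of_map_genericInclusion (map_genericPoint φ) ?_).symm
        rw [Spec.map_comp, Category.assoc, map_functionFieldMap_genericInclusion,
          ← Category.assoc, map_functionFieldMap_genericInclusion, Category.assoc]
        exact congrArg (genericInclusion C.left ≫ ·) (congrArg Over.Hom.left σ.2)
      exact ConcreteCategory.congr_hom h x }

theorem map_autGroupAlgHom (φ : C ⟶ D) [Nonconstant φ] (σ : autGroup φ) :
    Spec.map (show C.left.functionField ⟶ C.left.functionField from
      CommRingCat.ofHom (autGroupAlgHom φ σ).toRingHom) ≫ genericInclusion C.left =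
      genericInclusion C.left ≫ σ.1.hom.left :=
  have := nonconstant_of_mem_autGroup φ σ
  map_functionFieldMap_genericInclusion σ.1.hom.left (map_genericPoint σ.1.hom)

theorem autGroupAlgHom_eq (φ : C ⟶ D) [Nonconstant φ] (σ : autGroup φ)
    (θ : ExtensionField φ →ₐ[D.left.functionField] ExtensionField φ)
    (h : genericInclusion C.left ≫ σ.1.hom.left =
      Spec.map (show C.left.functionField ⟶ C.left.functionField from
        CommRingCat.ofHom θ.toRingHom) ≫ genericInclusion C.left) :
    autGroupAlgHom φ σ = θ := by
  rw [← map_autGroupAlgHom, cancel_mono] at h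
  refine AlgHom.ext fun x => ?_
  exact ConcreteCategory.congr_hom (Spec.map_injective h) x

theorem autGroupAlgHom_mul (φ : C ⟶ D) [Nonconstant φ] (σ τ : autGroup φ) :
    autGroupAlgHom φ (σ * τ) = autGroupAlgHom φ τ * autGroupAlgHom φ σ := by
  refine autGroupAlgHom_eq φ _ _ ?_
  let t (σ : autGroup φ) : C.left.functionField ⟶ C.left.functionField :=
    CommRingCat.ofHom (autGroupAlgHom φ σ).toRingHom
  have h (σ) : Spec.map (t σ) ≫ genericInclusion C.left =
    genericInclusion C.left ≫ σ.1.hom.left := map_autGroupAlgHom φ σ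
  change genericInclusion C.left ≫ τ.1.hom.left ≫ σ.1.hom.left =
    Spec.map (t σ ≫ t τ) ≫ genericInclusion C.left
  rw [Spec.map_comp, Category.assoc, h, ← Category.assoc, ← h, Category.assoc]

theorem autGroupAlgHom_injective (φ : C ⟶ D) [Nonconstant φ] :
    Function.Injective (autGroupAlgHom φ) := by
  intro σ τ h
  refine Subtype.ext (Iso.ext (hom_ext_of_genericInclusion ?_))
  rw [← map_autGroupAlgHom, h, map_autGroupAlgHom]

/-- Both `θ` and its inverse lift to endomorphisms of `C`; these are mutually inverse because they
are so at the generic point. -/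
theorem exists_autGroupAlgHom_eq (φ : C ⟶ D) [Nonconstant φ]
    (θ : ExtensionField φ ≃ₐ[D.left.functionField] ExtensionField φ) :
    ∃ σ, autGroupAlgHom φ σ = θ.toAlgHom := by
  obtain ⟨s, hs, hsθ⟩ := exists_hom_of_algHom φ θ.toAlgHom
  obtain ⟨s', hs', hsθ'⟩ := exists_hom_of_algHom φ θ.symm.toAlgHom
  let t : C.left.functionField ⟶ C.left.functionField := CommRingCat.ofHom θ.toAlgHom.toRingHom
  let t' : C.left.functionField ⟶ C.left.functionField :=
    CommRingCat.ofHom θ.symm.toAlgHom.toRingHom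
  have htt' : t ≫ t' = 𝟙 _ := CommRingCat.hom_ext (RingHom.ext fun x => θ.symm_apply_apply x)
  have ht't : t' ≫ t = 𝟙 _ := CommRingCat.hom_ext (RingHom.ext fun x => θ.apply_symm_apply x)
  have h : genericInclusion C.left ≫ s.left = Spec.map t ≫ genericInclusion C.left := hsθ
  have h' : genericInclusion C.left ≫ s'.left = Spec.map t' ≫ genericInclusion C.left := hsθ'
  have h1 : s ≫ s' = 𝟙 C := by
    refine hom_ext_of_genericInclusion ?_
    rw [Over.comp_left, ← Category.assoc, h, Category.assoc, h', ← Category.assoc,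
      ← Spec.map_comp, ht't, Spec.map_id, Category.id_comp, Over.id_left, Category.comp_id]
  have h2 : s' ≫ s = 𝟙 C := by
    refine hom_ext_of_genericInclusion ?_
    rw [Over.comp_left, ← Category.assoc, h', Category.assoc, h, ← Category.assoc,
      ← Spec.map_comp, htt', Spec.map_id, Category.id_comp, Over.id_left, Category.comp_id]
  exact ⟨⟨⟨s, s', h1, h2⟩, hs⟩, autGroupAlgHom_eq φ _ _ hsθ⟩

/-- The automorphism group of a cover is the opposite of the automorphism group of the extension
of function fields. -/
noncomputable def autGroupEquiv (φ : C ⟶ D) [Nonconstant φ]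
    [FiniteDimensional D.left.functionField (ExtensionField φ)] :
    autGroup φ ≃* (Gal(ExtensionField φ/D.left.functionField))ᵐᵒᵖ :=
  -- Endomorphisms of a finite extension are automorphisms.
  let e := algEquivEquivAlgHom D.left.functionField (ExtensionField φ)
  MulEquiv.ofBijective
    (MonoidHom.mk' (fun σ => MulOpposite.op (e.symm (autGroupAlgHom φ σ))) fun σ τ => by
      rw [autGroupAlgHom_mul, map_mul, MulOpposite.op_mul])
    ⟨fun σ τ h => autGroupAlgHom_injective φ (e.symm.injective (MulOpposite.op_injective h)),
      fun θ => by
        obtain ⟨σ, hσ⟩ := exists_autGroupAlgHom_eq φ θ.unop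
        refine ⟨σ, MulOpposite.unop_injective ?_⟩
        change e.symm (autGroupAlgHom φ σ) = θ.unop
        rw [MulEquiv.symm_apply_eq, hσ]
        rfl⟩

end CurveCover

theorem corollary6p4 {K : Type u} [Field K] {C D : Over (Spec (.of K))}
    [CurveCover.IsCurve C] [CurveCover.IsCurve D]
    (φ : C ⟶ D) [CurveCover.IsCover φ] (hφ : CurveCover.IsIndecomposable φ) :
    List.TFAE [
      (CurveCover.degree φ).Prime ∧
        (IsCyclic (CurveCover.autGroup φ) ∧
          Nat.card (CurveCover.autGroup φ) = CurveCover.degree φ) ∧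
        (IsCyclic (CurveCover.monodromyGroup φ) ∧
          Nat.card (CurveCover.monodromyGroup φ) = CurveCover.degree φ),
      ∀ σ τ : CurveCover.monodromyGroup φ, σ * τ = τ * σ,
      CurveCover.IsRegularAction (CurveCover.monodromyGroup φ) (CurveCover.embeddings φ),
      1 < ENat.card (CurveCover.autGroup φ)] := by
  have : FiniteDimensional D.left.functionField (CurveCover.ExtensionField φ) :=
    Module.finite_of_finrank_pos (zero_lt_two.trans_le hφ.1)
  have : Algebra.IsSeparable D.left.functionField (CurveCover.ExtensionField φ) :=
    CurveCover.IsCover.separable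
  exact CurveCover.tfae_of_forall_intermediateField hφ.1 hφ.eq_bot_or_eq_top
    (CurveCover.autGroupEquiv φ)
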